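/- Let $K$ be an algebraically closed field of characteristic zero, let $R=K[x_0,\dots,x_{c-1}]$ be the standard graded polynomial ring, let $I\subset R$ be a homogeneous ideal, and let $A=R/I$. Suppose that $A$ is artinian of socle degree $e\ge 3$ (that is, $e$ is the largest $j$ with $\dim_K[A]_j>0$) and that it has $h$-vector $(1,c,1,\dots,1)$, that is, $\dim_K[A]_1=c$ and $\dim_K[A]_j=1$ for $j=0$ and for $2\le j\le e$. Let $\beta_{i,j}=\dim_K[\operatorname{Tor}_i^R(A,K)]_j$ be the graded Betti numbers of $A$, where the graded pieces of $\operatorname{Tor}$ are computed by a graded free resolution of $A$ over $R$ by modules of finite rank (one exists, and the values below do not depend on the choice). Then: (1) After an invertible linear change of the coordinates $x_0,\dots,x_{c-1}$, $$I=\langle\, x_{c-1}^{e+1},\ x_ix_j \ \mid\ 0\le i,j\le c-1,\ (i,j)\neq(c-1,c-1)\,\rangle .$$ (2) The Betti table of $A$ is as follows: $\beta_{0,0}=1$ and $\beta_{0,j}=0$ for $j\ne 0$; for $1\le i\le c$, $$\beta_{i,e+i}=\binom{c-1}{i-1},\qquad \beta_{i,i+1}=i\binom{c+1}{i+1}-\binom{c-1}{i-1},$$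 and $\beta_{i,j}=0$ for all other $j$; and $\beta_{i,j}=0$ for all $j$ when $i>c$. -/

import Mathlib

noncomputable section

namespace BettiOfHVector

open MvPolynomial

/-- The degree `j` part `R(-a)_j = R_{j-a}` of the twisted polynomial ring
`R(-a)`, where `R = K[x_0, …, x_{c-1}]` (it is zero for `j < a`). -/
def twistPiece (K : Type*) [Field K] (c : ℕ) (a j : ℤ) :
    Submodule K (MvPolynomial (Fin c) K) :=
  if 0 ≤ j - a then homogeneousSubmodule (Fin c) K (j - a).toNat else ⊥

/-- `I` is a homogeneous ideal: it contains the homogeneous components of its elements. -/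
def IsHomogeneousIdeal {K : Type*} [Field K] {c : ℕ} (I : Ideal (MvPolynomial (Fin c) K)) :
    Prop :=
  ∀ p ∈ I, ∀ n : ℕ, homogeneousComponent n p ∈ I

/-- The degree `j` part `[R/I]_j` of `A = R/I`: the image of `R_j`. -/
def gradedPiece {K : Type*} [Field K] {c : ℕ} (I : Ideal (MvPolynomial (Fin c) K)) (j : ℤ) :
    Submodule K (MvPolynomial (Fin c) K ⧸ I) :=
  (twistPiece K c 0 j).map (Ideal.Quotient.mkₐ K I).toLinearMap

/-- The Hilbert function `HF_A(j) = dim_K [R/I]_j`. -/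
def hilbertFunction {K : Type*} [Field K] {c : ℕ} (I : Ideal (MvPolynomial (Fin c) K))
    (j : ℤ) : ℕ :=
  Module.finrank K (gradedPiece I j)

/-- `e` is the socle degree of `R/I`: the largest index at which the Hilbert function is
positive. -/
def IsSocleDegree {K : Type*} [Field K] {c : ℕ} (I : Ideal (MvPolynomial (Fin c) K))
    (e : ℕ) : Prop :=
  0 < hilbertFunction I e ∧ ∀ j : ℤ, (e : ℤ) < j → hilbertFunction I j = 0

/-- The linear substitution `x_i ↦ ∑_j g_{ij} x_j`; for invertible `g` it is a linear change of
coordinates. -/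
def linearSubst {K : Type*} [Field K] {c : ℕ} (g : Matrix (Fin c) (Fin c) K) :
    MvPolynomial (Fin c) K →ₐ[K] MvPolynomial (Fin c) K :=
  aeval fun i => ∑ j, C (g i j) * X j

/-- The ideal generated by `x_{c-1}^{e+1}` and by all `x_i x_j` with `0 ≤ i, j ≤ c-1` and
`(i, j) ≠ (c-1, c-1)`. -/
def normalFormIdeal (K : Type*) [Field K] (c e : ℕ) : Ideal (MvPolynomial (Fin c) K) :=
  Ideal.span
    ({p | ∃ i : Fin c, (i : ℕ) + 1 = c ∧ p = X i ^ (e + 1)} ∪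
     {p | ∃ i j : Fin c, ¬((i : ℕ) + 1 = c ∧ (j : ℕ) + 1 = c) ∧ p = X i * X j})

/-- A graded free resolution (by modules of finite rank) of the graded `R`-module `R/I`,
`… → F_2 → F_1 → F_0 → R/I → 0`, with `F_i = ⨁_k R(-deg i k)` and with differentials and
augmentation homogeneous of degree zero. The differential `F_{i+1} → F_i` is given by its matrix
and the augmentation by the images of the basis vectors of `F_0`. -/
structure GradedFreeResolution {K : Type*} [Field K] {c : ℕ}
    (I : Ideal (MvPolynomial (Fin c) K)) where
  /-- the rank of `F_i` -/
  rank : ℕ → ℕ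
  /-- the degrees of the basis vectors of `F_i` -/
  deg : (i : ℕ) → Fin (rank i) → ℤ
  /-- the matrix of the differential `F_{i+1} → F_i` -/
  d : (i : ℕ) → Matrix (Fin (rank i)) (Fin (rank (i + 1))) (MvPolynomial (Fin c) K)
  /-- the images in `R/I` of the basis vectors of `F_0` -/
  aug : Fin (rank 0) → MvPolynomial (Fin c) K ⧸ I
  d_homogeneous : ∀ i k l, d i k l ∈ twistPiece K c (deg i k) (deg (i + 1) l)
  aug_homogeneous : ∀ k, aug k ∈ gradedPiece I (deg 0 k)
  exact_succ : ∀ i, Function.Exact (d (i + 1)).mulVecLin (d i).mulVecLin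
  exact_zero : Function.Exact (d 0).mulVecLin
    (Fintype.linearCombination (MvPolynomial (Fin c) K) aug)
  aug_surjective :
    Function.Surjective (Fintype.linearCombination (MvPolynomial (Fin c) K) aug)

namespace GradedFreeResolution

variable {K : Type*} [Field K] {c : ℕ} {I : Ideal (MvPolynomial (Fin c) K)}

/-- The degree `j` part of `F_i ⊗_R K = K^{rank i}`, spanned by the basis vectors of degree `j`.
Here `K = R/(x_0, …, x_{c-1})`. -/
def redPiece (F : GradedFreeResolution I) (i : ℕ) (j : ℤ) :
    Submodule K (Fin (F.rank i) → K) :=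
  Submodule.span K {v | ∃ k, F.deg i k = j ∧ v = Pi.single k 1}

/-- The differential of `F ⊗_R K`: every matrix entry is replaced by its constant term. -/
def redDiff (F : GradedFreeResolution I) (i : ℕ) :
    (Fin (F.rank (i + 1)) → K) →ₗ[K] (Fin (F.rank i) → K) :=
  ((F.d i).map constantCoeff).mulVecLin

/-- All `i`-cycles of `F ⊗_R K`. -/
def redKer (F : GradedFreeResolution I) : (i : ℕ) → Submodule K (Fin (F.rank i) → K)
  | 0 => ⊤
  | i + 1 => LinearMap.ker (F.redDiff i)

/-- The `i`-cycles of degree `j` of `F ⊗_R K`. -/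
def cycles (F : GradedFreeResolution I) (i : ℕ) (j : ℤ) : Submodule K (Fin (F.rank i) → K) :=
  F.redKer i ⊓ F.redPiece i j

/-- The `i`-boundaries of degree `j` of `F ⊗_R K`. -/
def boundaries (F : GradedFreeResolution I) (i : ℕ) (j : ℤ) :
    Submodule K (Fin (F.rank i) → K) :=
  (F.redPiece (i + 1) j).map (F.redDiff i)

/-- `dim_K [Tor_i^R(R/I, K)]_j`, the dimension of the degree `j` part of the `i`-th homology of
`F ⊗_R K`: cycles of degree `j` modulo those cycles that are boundaries of degree `j`. -/
def bettiNumber (F : GradedFreeResolution I) (i : ℕ) (j : ℤ) : ℕ :=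
  Module.finrank K (F.cycles i j ⧸ (F.boundaries i j).submoduleOf (F.cycles i j))

end GradedFreeResolution

end BettiOfHVector

end

/-! The normal form comes from commutativity in degree three. Let `w` span $A_2$ and `τ` span $A_3$,
and write $x_ix_j = B_{ij}w$ and $x_kw = \lambda_k\tau$. Comparing $x_k(x_ix_j)$ with $x_i(x_kx_j)$
gives $B_{ij}\lambda_k = B_{kj}\lambda_i$, and $\lambda \ne 0$ because $A_1A_2$ spans $A_3$. Hence a
linear form $\sum y_ix_i$ with $\sum y_i\lambda_i = 0$ annihilates $A_1$ (`exists_functional`).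
Coordinates adapted to $\lambda$ put the monomial ideal inside the transformed $I$, and the Hilbert
function forces equality (`map_linearSubst_eq_normalFormIdeal`).

For the Betti numbers, let $F$ be any graded free resolution, minimal or not, and let $J_k$ be
generated by the first $k$ forms of a basis of linear forms, beginning with the one that corresponds
to $x_{c-1}$. The next form is regular modulo $J_k$, so $0 \to (F/J_kF)(-1) \to F/J_kF \to
F/J_{k+1}F \to 0$ is exact, and its long exact sequence becomes a recurrence in $k$ between the
dimensions $t_k(i,j)$ of $H_i(F/J_kF)_j$ and the dimensions $s_k(i,j)$ of the kernels of
multiplication (`relBetti_succ`, `relBetti_zero`). At $k=0$ the homology is $A$ itself; at $k=c$ it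
is $\operatorname{Tor}(A,K)$ (`bettiNumber_eq_relBetti`).

The recurrence determines everything. From $k=1$ on, $A/J_kA$ has Hilbert function $(1,c-k)$. For $i
\ge 1$, $H_i(F/J_kF)$ sits in the degrees $e+i$ and $i+1$, which are not consecutive since $e\ge 3$;
so every later linear form acts on it as zero, and the dimensions add up by Pascal's rule
(`recurrence_row_succ`). -/

noncomputable section

namespace BettiOfHVector

open MvPolynomial

/-! ### Degree pieces of the polynomial ring, indexed by integers -/

section Pieces

variable {K : Type*} [Field K] {c : ℕ}

/-- The degree `n` part of the polynomial ring, for an integer `n`. -/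
def piece (K : Type*) [Field K] (c : ℕ) (n : ℤ) : Submodule K (MvPolynomial (Fin c) K) :=
  if 0 ≤ n then homogeneousSubmodule (Fin c) K n.toNat else ⊥

/-- The projection onto the degree `n` part of the polynomial ring. -/
def pieceProj (K : Type*) [Field K] (c : ℕ) (n : ℤ) :
    MvPolynomial (Fin c) K →ₗ[K] MvPolynomial (Fin c) K :=
  if 0 ≤ n then homogeneousComponent n.toNat else 0

theorem twistPiece_eq_piece (a j : ℤ) : twistPiece K c a j = piece K c (j - a) := rfl

theorem piece_natCast (n : ℕ) : piece K c n = homogeneousSubmodule (Fin c) K n := by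
  simp [piece]

theorem piece_of_neg {n : ℤ} (hn : n < 0) : piece K c n = ⊥ := by
  simp [piece, hn]

theorem mem_piece_natCast {n : ℕ} {p : MvPolynomial (Fin c) K} :
    p ∈ piece K c n ↔ p.IsHomogeneous n := by
  rw [piece_natCast, mem_homogeneousSubmodule]

theorem pieceProj_mem (n : ℤ) (p : MvPolynomial (Fin c) K) :
    pieceProj K c n p ∈ piece K c n := by
  unfold pieceProj piece
  split_ifs
  · exact homogeneousComponent_mem _ _
  · simp

theorem pieceProj_of_mem {n : ℤ} {p : MvPolynomial (Fin c) K} (hp : p ∈ piece K c n) :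
    pieceProj K c n p = p := by
  unfold pieceProj
  unfold piece at hp
  split_ifs at hp ⊢
  · simp [homogeneousComponent_of_mem hp]
  · simpa using hp.symm

theorem pieceProj_of_mem_of_ne {m n : ℤ} {p : MvPolynomial (Fin c) K} (hp : p ∈ piece K c m)
    (hmn : n ≠ m) : pieceProj K c n p = 0 := by
  unfold pieceProj
  unfold piece at hp
  split_ifs at hp ⊢
  · rw [homogeneousComponent_of_mem hp, if_neg (by omega)]
  · simp only [Submodule.mem_bot] at hp
    simp [hp]
  · rfl
  · rfl

theorem mul_mem_piece {m n : ℤ} {p q : MvPolynomial (Fin c) K} (hp : p ∈ piece K c m)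
    (hq : q ∈ piece K c n) : p * q ∈ piece K c (m + n) := by
  rcases lt_or_ge m 0 with hm | hm
  · rw [piece_of_neg hm, Submodule.mem_bot] at hp
    simp [hp]
  rcases lt_or_ge n 0 with hn | hn
  · rw [piece_of_neg hn, Submodule.mem_bot] at hq
    simp [hq]
  lift m to ℕ using hm
  lift n to ℕ using hn
  rw [mem_piece_natCast] at hp hq
  rw [← Nat.cast_add, mem_piece_natCast]
  exact hp.mul hq

/-- Projection commutes with multiplication by a form up to a degree shift. Everything that passes
from a statement on whole modules to a single degree rests on this. -/
theorem pieceProj_mul {m : ℤ} {p : MvPolynomial (Fin c) K} (hp : p ∈ piece K c m) (n : ℤ)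
    (q : MvPolynomial (Fin c) K) :
    pieceProj K c (m + n) (p * q) = p * pieceProj K c n q := by
  induction q using MvPolynomial.induction_on' with
  | monomial d a =>
    have hd : monomial d a ∈ piece K c (d.degree : ℤ) :=
      mem_piece_natCast.2 (isHomogeneous_monomial a rfl)
    by_cases h : n = d.degree
    · subst h
      rw [pieceProj_of_mem hd, pieceProj_of_mem (mul_mem_piece hp hd)]
    · rw [pieceProj_of_mem_of_ne hd h, mul_zero,
        pieceProj_of_mem_of_ne (mul_mem_piece hp hd) (by omega)]
  | add q₁ q₂ h₁ h₂ => rw [mul_add, map_add, map_add, h₁, h₂, mul_add]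

instance finiteDimensional_piece (n : ℤ) : FiniteDimensional K (piece K c n) := by
  rcases lt_or_ge n 0 with hn | hn
  · rw [piece_of_neg hn]
    infer_instance
  · lift n to ℕ using hn
    rw [piece_natCast]
    exact Module.Finite.iff_fg.2 (homogeneousSubmodule_fg _ _ _)

theorem IsHomogeneousIdeal.pieceProj_mem {I : Ideal (MvPolynomial (Fin c) K)}
    (hI : IsHomogeneousIdeal I) {p : MvPolynomial (Fin c) K} (hp : p ∈ I) (n : ℤ) :
    pieceProj K c n p ∈ I := by
  unfold pieceProj
  split_ifs
  · exact hI p hp _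
  · simp

end Pieces

/-! ### Dimension counts -/

section DimensionCounts

variable {K V W W' : Type*} [Field K] [AddCommGroup V] [Module K V]
  [AddCommGroup W] [Module K W] [AddCommGroup W'] [Module K W']
  [FiniteDimensional K V] [FiniteDimensional K W] [FiniteDimensional K W']

/-- This counts both sides of $V/f^{-1}(N) \cong (N + \operatorname{im} f)/N$. -/
theorem finrank_sup_range_add_finrank_comap (f : V →ₗ[K] W) (N : Submodule K W) :
    Module.finrank K ↥(N ⊔ LinearMap.range f) + Module.finrank K ↥(N.comap f) =
      Module.finrank K N + Module.finrank K V := by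
  have h1 := LinearMap.finrank_range_add_finrank_ker (N.mkQ.comp f)
  have h2 := LinearMap.finrank_range_add_finrank_ker (N.mkQ.domRestrict (N ⊔ LinearMap.range f))
  have e1 : LinearMap.ker (N.mkQ.comp f) = N.comap f := by
    rw [LinearMap.ker_comp, Submodule.ker_mkQ]
  have e2 : LinearMap.range (N.mkQ.domRestrict (N ⊔ LinearMap.range f)) =
      LinearMap.range (N.mkQ.comp f) := by
    rw [LinearMap.range_domRestrict, Submodule.map_sup, LinearMap.range_comp]
    simp
  have e3 : Module.finrank K (LinearMap.ker (N.mkQ.domRestrict (N ⊔ LinearMap.range f))) =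
      Module.finrank K N := by
    rw [LinearMap.ker_domRestrict, Submodule.ker_mkQ]
    exact (Submodule.submoduleOfEquivOfLe le_sup_left).finrank_eq
  rw [e1] at h1
  rw [e2, e3] at h2
  omega

/-- Both sides are the dimension of $\{(v,w) : dv + lw \in N\}$, computed through its two
projections. -/
theorem finrank_comap_sup_range_add (d : V →ₗ[K] W) (l : W' →ₗ[K] W) (N : Submodule K W) :
    Module.finrank K ↥((N ⊔ LinearMap.range l).comap d) + Module.finrank K ↥(N.comap l) =
      Module.finrank K ↥((N ⊔ LinearMap.range d).comap l) + Module.finrank K ↥(N.comap d) := by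
  have h1 := finrank_sup_range_add_finrank_comap d (N ⊔ LinearMap.range l)
  have h2 := finrank_sup_range_add_finrank_comap l N
  have h3 := finrank_sup_range_add_finrank_comap l (N ⊔ LinearMap.range d)
  have h4 := finrank_sup_range_add_finrank_comap d N
  rw [sup_right_comm] at h3
  omega

/-- The map `l` embeds $Z/(Z \cap l^{-1}B)$ in $Z'/B$. -/
theorem finrank_add_le_of_map_le (l : V →ₗ[K] W) {Z : Submodule K V} {B Z' : Submodule K W}
    (hB : B ≤ Z') (hZ : Z.map l ≤ Z') :
    Module.finrank K Z + Module.finrank K B ≤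
      Module.finrank K ↥(B.comap l) + Module.finrank K Z' := by
  have h1 := finrank_sup_range_add_finrank_comap (l.domRestrict Z) B
  have h2 : B ⊔ LinearMap.range (l.domRestrict Z) ≤ Z' := by
    rw [LinearMap.range_domRestrict]
    exact sup_le hB hZ
  have h3 : Module.finrank K ↥(B.comap (l.domRestrict Z)) ≤ Module.finrank K ↥(B.comap l) := by
    rw [LinearMap.domRestrict, Submodule.comap_comp]
    rw [← Submodule.finrank_map_subtype_eq Z, Submodule.map_comap_subtype]
    exact Submodule.finrank_mono inf_le_right
  have h4 := Submodule.finrank_mono h2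
  omega

omit [FiniteDimensional K W] in
theorem finrank_map_add_finrank_ker (f : V →ₗ[K] W) {Z : Submodule K V}
    (hZ : LinearMap.ker f ≤ Z) :
    Module.finrank K ↥(Z.map f) + Module.finrank K ↥(LinearMap.ker f) = Module.finrank K Z := by
  rw [← LinearMap.finrank_range_add_finrank_ker (f.domRestrict Z), LinearMap.range_domRestrict,
    LinearMap.ker_domRestrict]
  congr 1
  exact (Submodule.submoduleOfEquivOfLe hZ).finrank_eq.symm

end DimensionCounts

/-! ### Graded strands of free modules -/

section Strands

variable {K : Type*} [Field K] {c : ℕ} {ι κ : Type*}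

/-- The degree `j` part of the free module `⨁ R(-a k)`. -/
def strand (K : Type*) [Field K] (c : ℕ) (a : ι → ℤ) (j : ℤ) :
    Submodule K (ι → MvPolynomial (Fin c) K) :=
  Submodule.pi Set.univ fun k => piece K c (j - a k)

/-- The projection of the free module `⨁ R(-a k)` onto its degree `j` part. -/
def strandProj (K : Type*) [Field K] (c : ℕ) (a : ι → ℤ) (j : ℤ) :
    (ι → MvPolynomial (Fin c) K) →ₗ[K] (ι → MvPolynomial (Fin c) K) :=
  LinearMap.pi fun k => pieceProj K c (j - a k) ∘ₗ LinearMap.proj k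

theorem mem_strand {a : ι → ℤ} {j : ℤ} {v : ι → MvPolynomial (Fin c) K} :
    v ∈ strand K c a j ↔ ∀ k, v k ∈ piece K c (j - a k) := by
  simp [strand]

@[simp]
theorem strandProj_apply (a : ι → ℤ) (j : ℤ) (v : ι → MvPolynomial (Fin c) K) (k : ι) :
    strandProj K c a j v k = pieceProj K c (j - a k) (v k) := rfl

theorem strandProj_mem (a : ι → ℤ) (j : ℤ) (v : ι → MvPolynomial (Fin c) K) :
    strandProj K c a j v ∈ strand K c a j :=
  mem_strand.2 fun _ => pieceProj_mem _ _

theorem strandProj_of_mem {a : ι → ℤ} {j : ℤ} {v : ι → MvPolynomial (Fin c) K}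
    (hv : v ∈ strand K c a j) : strandProj K c a j v = v :=
  funext fun k => pieceProj_of_mem (mem_strand.1 hv k)

theorem smul_mem_strand {a : ι → ℤ} {i j : ℤ} {p : MvPolynomial (Fin c) K}
    {v : ι → MvPolynomial (Fin c) K} (hp : p ∈ piece K c i) (hv : v ∈ strand K c a j) :
    p • v ∈ strand K c a (i + j) :=
  mem_strand.2 fun k => by
    rw [add_sub_assoc]
    exact mul_mem_piece hp (mem_strand.1 hv k)

instance finiteDimensional_strand [Finite ι] (a : ι → ℤ) (j : ℤ) :
    FiniteDimensional K (strand K c a j) := by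
  let f : strand K c a j →ₗ[K] ∀ k, piece K c (j - a k) :=
    LinearMap.pi fun k => ((LinearMap.proj k).domRestrict _).codRestrict _
      fun v => mem_strand.1 v.2 k
  refine FiniteDimensional.of_injective f fun v w h => Subtype.ext (funext fun k => ?_)
  exact congrArg Subtype.val (congrFun h k)

variable [Fintype κ]

/-- A homogeneous matrix commutes with taking components, so a preimage found in the whole module
may be replaced by its component of the right degree. Exactness therefore descends to each degree.
-/
theorem strandProj_mulVec {a : ι → ℤ} {b : κ → ℤ} {D : Matrix ι κ (MvPolynomial (Fin c) K)}
    (hD : ∀ k l, D k l ∈ piece K c (b l - a k)) (j : ℤ) (v : κ → MvPolynomial (Fin c) K) :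
    strandProj K c a j (D.mulVec v) = D.mulVec (strandProj K c b j v) := by
  funext k
  simp only [strandProj_apply, Matrix.mulVec, dotProduct, map_sum]
  refine Finset.sum_congr rfl fun l _ => ?_
  rw [← pieceProj_mul (hD k l), show b l - a k + (j - b l) = j - a k by ring]

theorem mulVec_mem_strand {a : ι → ℤ} {b : κ → ℤ} {D : Matrix ι κ (MvPolynomial (Fin c) K)}
    (hD : ∀ k l, D k l ∈ piece K c (b l - a k)) {j : ℤ} {v : κ → MvPolynomial (Fin c) K}
    (hv : v ∈ strand K c b j) : D.mulVec v ∈ strand K c a j := by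
  rw [← strandProj_of_mem hv, ← strandProj_mulVec hD]
  exact strandProj_mem _ _ _

end Strands

/-! ### Homology of $F/JF$ in a single degree. -/

namespace GradedFreeResolution

variable {K : Type*} [Field K] {c : ℕ} {I : Ideal (MvPolynomial (Fin c) K)}
  (F : GradedFreeResolution I)

/-- The degree `j` part of `F_i`. -/
abbrev V (i : ℕ) (j : ℤ) : Submodule K (Fin (F.rank i) → MvPolynomial (Fin c) K) :=
  strand K c (F.deg i) j

theorem d_mem_piece (i : ℕ) (k : Fin (F.rank i)) (l : Fin (F.rank (i + 1))) :
    F.d i k l ∈ piece K c (F.deg (i + 1) l - F.deg i k) :=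
  F.d_homogeneous i k l

/-- The degree `j` part of the differential `F_{i+1} → F_i`. -/
def diff (i : ℕ) (j : ℤ) : F.V (i + 1) j →ₗ[K] F.V i j :=
  ((F.d i).mulVecLin.restrictScalars K).restrict fun _ hv =>
    mulVec_mem_strand (F.d_mem_piece i) hv

@[simp]
theorem coe_diff (i : ℕ) (j : ℤ) (v : F.V (i + 1) j) :
    (F.diff i j v : Fin (F.rank i) → MvPolynomial (Fin c) K) = (F.d i).mulVec v := rfl

theorem diff_diff (i : ℕ) (j : ℤ) (v : F.V (i + 2) j) : F.diff i j (F.diff (i + 1) j v) = 0 :=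
  Subtype.ext ((F.exact_succ i).apply_apply_eq_zero _)

/-- The degree `j` part of `J F_i`, for a homogeneous ideal `J`. -/
def idealPart (J : Ideal (MvPolynomial (Fin c) K)) (i : ℕ) (j : ℤ) : Submodule K (F.V i j) where
  carrier := {v | ∀ k, v.1 k ∈ J}
  add_mem' ha hb k := J.add_mem (ha k) (hb k)
  zero_mem' _ := J.zero_mem
  smul_mem' a v hv k := by
    simpa [MvPolynomial.smul_eq_C_mul] using J.mul_mem_left (C a) (hv k)

theorem mem_idealPart {J : Ideal (MvPolynomial (Fin c) K)} {i : ℕ} {j : ℤ} {v : F.V i j} :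
    v ∈ F.idealPart J i j ↔ ∀ k, v.1 k ∈ J := Iff.rfl

/-- Elements of degree `j` of `F_i` which are cycles modulo `J`. -/
def relCycles (J : Ideal (MvPolynomial (Fin c) K)) : (i : ℕ) → (j : ℤ) → Submodule K (F.V i j)
  | 0, _ => ⊤
  | i + 1, j => (F.idealPart J i j).comap (F.diff i j)

/-- Elements of degree `j` of `F_i` which are boundaries modulo `J`. -/
def relBoundaries (J : Ideal (MvPolynomial (Fin c) K)) (i : ℕ) (j : ℤ) : Submodule K (F.V i j) :=
  F.idealPart J i j ⊔ LinearMap.range (F.diff i j)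

/-- The dimension of the degree `j` part of the `i`-th homology of `F / J F`. -/
def relBetti (J : Ideal (MvPolynomial (Fin c) K)) (i : ℕ) (j : ℤ) : ℕ :=
  Module.finrank K (F.relCycles J i j) - Module.finrank K (F.relBoundaries J i j)

theorem diff_mem_idealPart {J : Ideal (MvPolynomial (Fin c) K)} {i : ℕ} {j : ℤ}
    {v : F.V (i + 1) j} (hv : v ∈ F.idealPart J (i + 1) j) :
    F.diff i j v ∈ F.idealPart J i j := by
  intro k
  change ∑ l, F.d i k l * v.1 l ∈ J
  exact J.sum_mem fun l _ => J.mul_mem_left _ (hv l)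

theorem idealPart_le_relCycles (J : Ideal (MvPolynomial (Fin c) K)) (i : ℕ) (j : ℤ) :
    F.idealPart J i j ≤ F.relCycles J i j := by
  cases i with
  | zero => exact le_top
  | succ i => exact fun v hv => F.diff_mem_idealPart hv

theorem relBoundaries_le_relCycles (J : Ideal (MvPolynomial (Fin c) K)) (i : ℕ) (j : ℤ) :
    F.relBoundaries J i j ≤ F.relCycles J i j := by
  refine sup_le (F.idealPart_le_relCycles J i j) ?_
  cases i with
  | zero => exact le_top
  | succ i =>
    rintro _ ⟨v, rfl⟩
    change F.diff i j _ ∈ F.idealPart J i j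
    rw [diff_diff]
    exact Submodule.zero_mem _

/-- Boundaries are cycles, so the truncated subtraction in `relBetti` loses nothing. -/
theorem relBetti_add (J : Ideal (MvPolynomial (Fin c) K)) (i : ℕ) (j : ℤ) :
    F.relBetti J i j + Module.finrank K (F.relBoundaries J i j) =
      Module.finrank K (F.relCycles J i j) :=
  Nat.sub_add_cancel (Submodule.finrank_mono (F.relBoundaries_le_relCycles J i j))

/-! ### Multiplication by a linear form -/

section Mul

variable {l : MvPolynomial (Fin c) K} (hl : l ∈ piece K c 1)

/-- Multiplication by a linear form on the degree `j` part of `F_i`. -/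
def mulForm (i : ℕ) (j : ℤ) : F.V i j →ₗ[K] F.V i (j + 1) :=
  (l • (LinearMap.id : (Fin (F.rank i) → MvPolynomial (Fin c) K) →ₗ[K] _)).restrict fun _ hv => by
    rw [add_comm]
    exact smul_mem_strand hl hv

theorem diff_mulForm (i : ℕ) (j : ℤ) (v : F.V (i + 1) j) :
    F.diff i (j + 1) (F.mulForm hl (i + 1) j v) = F.mulForm hl i j (F.diff i j v) :=
  Subtype.ext (Matrix.mulVec_smul (F.d i) l v.1)

/-- The dimension of the kernel of multiplication by a linear form on the degree `j` part of the
`i`-th homology of `F / J F`. -/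
def relKer (J : Ideal (MvPolynomial (Fin c) K)) (i : ℕ) (j : ℤ) : ℕ :=
  Module.finrank K ((F.relBoundaries J i (j + 1)).comap (F.mulForm hl i j)) -
    Module.finrank K (F.relBoundaries J i j)

variable {J : Ideal (MvPolynomial (Fin c) K)}

theorem mulForm_mem_idealPart {i : ℕ} {j : ℤ} {v : F.V i j} (hv : v ∈ F.idealPart J i j) :
    F.mulForm hl i j v ∈ F.idealPart J i (j + 1) := fun k =>
  J.mul_mem_left _ (hv k)

theorem relBoundaries_le_comap (i : ℕ) (j : ℤ) :
    F.relBoundaries J i j ≤ (F.relBoundaries J i (j + 1)).comap (F.mulForm hl i j) := by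
  refine sup_le (fun v hv => ?_) ?_
  · exact Submodule.mem_sup_left (F.mulForm_mem_idealPart hl hv)
  · rintro _ ⟨v, rfl⟩
    exact Submodule.mem_sup_right ⟨F.mulForm hl _ _ v, F.diff_mulForm hl _ _ v⟩

theorem relKer_add (i : ℕ) (j : ℤ) :
    F.relKer hl J i j + Module.finrank K (F.relBoundaries J i j) =
      Module.finrank K ((F.relBoundaries J i (j + 1)).comap (F.mulForm hl i j)) :=
  Nat.sub_add_cancel (Submodule.finrank_mono (F.relBoundaries_le_comap hl i j))

theorem comap_idealPart (hreg : ∀ p, l * p ∈ J → p ∈ J) (i : ℕ) (j : ℤ) :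
    (F.idealPart J i (j + 1)).comap (F.mulForm hl i j) = F.idealPart J i j := by
  ext v
  rw [Submodule.mem_comap]
  refine ⟨fun hv => ?_, fun hv => F.mulForm_mem_idealPart hl hv⟩
  rw [mem_idealPart] at hv ⊢
  exact fun k => hreg _ (hv k)

/-- If $lv$ is a boundary modulo $J$, then $l\,dv = d(lv)$ lies in $JF$, and regularity cancels $l$.
So only cycles are counted by `relKer`, which is thus the dimension of a kernel on homology. -/
theorem comap_relBoundaries_le (hreg : ∀ p, l * p ∈ J → p ∈ J) (i : ℕ) (j : ℤ) :
    (F.relBoundaries J i (j + 1)).comap (F.mulForm hl i j) ≤ F.relCycles J i j := by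
  intro v hv
  cases i with
  | zero => exact Submodule.mem_top
  | succ i =>
    have h : F.diff i (j + 1) (F.mulForm hl (i + 1) j v) ∈ F.idealPart J i (j + 1) :=
      F.relBoundaries_le_relCycles J (i + 1) (j + 1) hv
    rw [diff_mulForm] at h
    rwa [← Submodule.mem_comap, F.comap_idealPart hl hreg] at h

theorem relKer_le_relBetti (hreg : ∀ p, l * p ∈ J → p ∈ J) (i : ℕ) (j : ℤ) :
    F.relKer hl J i j ≤ F.relBetti J i j :=
  Nat.sub_le_sub_right (Submodule.finrank_mono (F.comap_relBoundaries_le hl hreg i j)) _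

/-- Rank–nullity: the image of multiplication by the form lies in the homology one degree up. Where
that vanishes, multiplication is zero. -/
theorem relBetti_le_relKer_add (i : ℕ) (j : ℤ) :
    F.relBetti J i j ≤ F.relKer hl J i j + F.relBetti J i (j + 1) := by
  have hmap : ∀ v ∈ F.relCycles J i j, F.mulForm hl i j v ∈ F.relCycles J i (j + 1) := by
    intro v hv
    cases i with
    | zero => exact Submodule.mem_top
    | succ i =>
      change F.diff i (j + 1) (F.mulForm hl (i + 1) j v) ∈ F.idealPart J i (j + 1)
      rw [diff_mulForm]
      exact F.mulForm_mem_idealPart hl hv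
  have h1 : Module.finrank K (F.relCycles J i j) +
      Module.finrank K (F.relBoundaries J i (j + 1)) ≤
      Module.finrank K ((F.relBoundaries J i (j + 1)).comap (F.mulForm hl i j)) +
      Module.finrank K (F.relCycles J i (j + 1)) :=
    finrank_add_le_of_map_le _ (F.relBoundaries_le_relCycles J i (j + 1))
      (Submodule.map_le_iff_le_comap.2 hmap)
  have h5 := F.relKer_add hl (J := J) i j
  have h6 := F.relBetti_add J i j
  have h7 := F.relBetti_add J i (j + 1)
  omega

variable {J' : Ideal (MvPolynomial (Fin c) K)}

theorem idealPart_sup (hJ : IsHomogeneousIdeal J) (hJ' : J' = J ⊔ Ideal.span {l}) (i : ℕ)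
    (j : ℤ) :
    F.idealPart J' i (j + 1) = F.idealPart J i (j + 1) ⊔ LinearMap.range (F.mulForm hl i j) := by
  subst hJ'
  apply le_antisymm
  · intro v hv
    have h : ∀ k, ∃ p ∈ J, ∃ q, p + l * q = v.1 k := fun k => by
      obtain ⟨p, hp, r, hr, h⟩ := Submodule.mem_sup.1 (hv k)
      obtain ⟨q, rfl⟩ := Ideal.mem_span_singleton'.1 hr
      exact ⟨p, hp, q, by rw [← h, mul_comm]⟩
    choose p hp q hq using h
    -- The coefficients $p$ and $q$ need not be homogeneous; their components of the right degrees
    -- still represent $v$, and homogeneity of $J$ keeps that of $p$ in $J$.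
    let w : F.V i j := ⟨_, strandProj_mem (F.deg i) j q⟩
    refine Submodule.mem_sup.2 ⟨⟨_, strandProj_mem (F.deg i) (j + 1) p⟩,
      fun k => hJ.pieceProj_mem (hp k) _, F.mulForm hl i j w, ⟨w, rfl⟩, Subtype.ext ?_⟩
    funext k
    change pieceProj K c (j + 1 - F.deg i k) (p k) + l * pieceProj K c (j - F.deg i k) (q k) = _
    rw [← pieceProj_mul hl, show 1 + (j - F.deg i k) = j + 1 - F.deg i k by ring, ← map_add, hq]
    exact pieceProj_of_mem (mem_strand.1 v.2 k)
  · refine sup_le (fun v hv k => Ideal.mem_sup_left (hv k)) ?_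
    rintro _ ⟨v, rfl⟩ k
    exact Ideal.mem_sup_right (Ideal.mul_mem_right _ _ (Ideal.mem_span_singleton_self l))

theorem finrank_relBoundaries_sup (hJ : IsHomogeneousIdeal J) (hJ' : J' = J ⊔ Ideal.span {l})
    (i : ℕ) (j : ℤ) :
    Module.finrank K (F.relBoundaries J' i (j + 1)) + F.relKer hl J i j +
        Module.finrank K (F.relBoundaries J i j) =
      Module.finrank K (F.relBoundaries J i (j + 1)) + Module.finrank K (F.V i j) := by
  rw [add_assoc, relKer_add, relBoundaries, F.idealPart_sup hl hJ hJ', sup_right_comm]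
  exact finrank_sup_range_add_finrank_comap _ _

theorem finrank_V_add (i : ℕ) (j : ℤ) :
    Module.finrank K (F.relBoundaries J i j) + Module.finrank K (F.relCycles J (i + 1) j) =
      Module.finrank K (F.idealPart J i j) + Module.finrank K (F.V (i + 1) j) :=
  finrank_sup_range_add_finrank_comap _ _

/-- This is the long exact sequence of $0 \to (F/JF)(-1) \to F/JF \to F/J'F \to 0$ in numbers:
$H_{i+1}(F/J'F)$ is made of the cokernel of $l$ on $H_{i+1}(F/JF)$ and the kernel of $l$ on
$H_i(F/JF)$. -/
theorem relBetti_succ (hJ : IsHomogeneousIdeal J) (hJ' : J' = J ⊔ Ideal.span {l})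
    (hreg : ∀ p, l * p ∈ J → p ∈ J) (i : ℕ) (j : ℤ) :
    F.relBetti J' (i + 1) (j + 1) + F.relBetti J (i + 1) j =
      F.relBetti J (i + 1) (j + 1) + F.relKer hl J (i + 1) j + F.relKer hl J i j := by
  have h1 := F.finrank_relBoundaries_sup hl hJ hJ' (i + 1) j
  have h2 := F.finrank_V_add (J := J) i j
  -- Cycles modulo $J'$ are the preimage of $JF + lF$ under $d$. Exchanging $d$ and $l$ in the count
  -- turns this into the preimage of $JF + dF$ under $l$, whence the connecting term.
  have h3 : Module.finrank K (F.relCycles J' (i + 1) (j + 1)) +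
      Module.finrank K (F.idealPart J i j) =
      Module.finrank K ((F.relBoundaries J i (j + 1)).comap (F.mulForm hl i j)) +
      Module.finrank K (F.relCycles J (i + 1) (j + 1)) := by
    rw [relCycles, F.idealPart_sup hl hJ hJ', ← F.comap_idealPart hl hreg i j]
    exact finrank_comap_sup_range_add _ _ _
  have h4 := F.relKer_add hl (J := J) i j
  have h5 := F.relBetti_add J (i + 1) j
  have h6 := F.relBetti_add J (i + 1) (j + 1)
  have h7 := F.relBetti_add J' (i + 1) (j + 1)
  omega

theorem relBetti_zero (hJ : IsHomogeneousIdeal J) (hJ' : J' = J ⊔ Ideal.span {l}) (j : ℤ) :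
    F.relBetti J' 0 (j + 1) + F.relBetti J 0 j =
      F.relBetti J 0 (j + 1) + F.relKer hl J 0 j := by
  have h1 := F.finrank_relBoundaries_sup hl hJ hJ' 0 j
  have h5 := F.relBetti_add J 0 j
  have h6 := F.relBetti_add J 0 (j + 1)
  have h7 := F.relBetti_add J' 0 (j + 1)
  have h8 (J : Ideal (MvPolynomial (Fin c) K)) (j : ℤ) :
      Module.finrank K (F.relCycles J 0 j) = Module.finrank K (F.V 0 j) := finrank_top K (F.V 0 j)
  rw [h8] at h5 h6 h7
  omega

end Mul

/-! ### The two extreme cases -/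

theorem idealPart_bot (i : ℕ) (j : ℤ) : F.idealPart ⊥ i j = ⊥ := by
  refine (Submodule.eq_bot_iff _).2 fun v hv => Subtype.ext (funext fun k => ?_)
  simpa using hv k

/-- Exactness of $F$ gives a preimage, whose degree $j$ component is again one. -/
theorem relBetti_bot_succ (i : ℕ) (j : ℤ) : F.relBetti ⊥ (i + 1) j = 0 := by
  refine Nat.sub_eq_zero_of_le (Submodule.finrank_mono fun v hv => ?_)
  rw [relCycles, idealPart_bot, Submodule.mem_comap, Submodule.mem_bot] at hv
  obtain ⟨w, hw⟩ := (F.exact_succ i v.1).1 (congrArg Subtype.val hv)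
  refine Submodule.mem_sup_right ⟨⟨_, strandProj_mem (F.deg (i + 2)) j w⟩, Subtype.ext ?_⟩
  rw [coe_diff, ← strandProj_mulVec (F.d_mem_piece (i + 1))]
  change strandProj K c _ j ((F.d (i + 1)).mulVecLin w) = _
  rw [hw, strandProj_of_mem v.2]

theorem exists_aug_lift : ∃ P : Fin (F.rank 0) → MvPolynomial (Fin c) K,
    (∀ k, P k ∈ piece K c (F.deg 0 k)) ∧
    ∀ v, Fintype.linearCombination (MvPolynomial (Fin c) K) F.aug v =
      Ideal.Quotient.mk I (∑ k, v k * P k) := by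
  have h : ∀ k, ∃ p ∈ piece K c (F.deg 0 k), Ideal.Quotient.mk I p = F.aug k := fun k => by
    obtain ⟨p, hp, h⟩ := F.aug_homogeneous k
    rw [SetLike.mem_coe, twistPiece_eq_piece, sub_zero] at hp
    exact ⟨p, hp, h⟩
  choose P hP h using h
  refine ⟨P, hP, fun v => ?_⟩
  simp only [Fintype.linearCombination_apply, map_sum, map_mul, ← h]
  rfl

/-- The augmentation of the resolution, in degree `j`. -/
def augPiece (j : ℤ) : F.V 0 j →ₗ[K] MvPolynomial (Fin c) K ⧸ I :=
  ((Fintype.linearCombination (MvPolynomial (Fin c) K) F.aug).restrictScalars K).domRestrict _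

/-- A preimage under the augmentation may be inhomogeneous; since $I$ is homogeneous, its degree $j$
component maps to the same class. -/
theorem mem_range_augPiece (hI : IsHomogeneousIdeal I) {j : ℤ} {p : MvPolynomial (Fin c) K}
    (hp : p ∈ piece K c j) : ∃ v, F.augPiece j v = Ideal.Quotient.mk I p := by
  obtain ⟨P, hP, h⟩ := F.exists_aug_lift
  obtain ⟨v, hv⟩ := F.aug_surjective (Ideal.Quotient.mk I p)
  refine ⟨⟨_, strandProj_mem (F.deg 0) j v⟩, ?_⟩
  change Fintype.linearCombination (MvPolynomial (Fin c) K) F.aug _ = _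
  rw [h, Ideal.Quotient.mk_eq_mk_iff_sub_mem] at hv ⊢
  have := hI.pieceProj_mem hv j
  rw [map_sub, map_sum, pieceProj_of_mem hp] at this
  convert this using 3 with k
  change pieceProj K c (j - F.deg 0 k) (v k) * P k = _
  rw [mul_comm, ← pieceProj_mul (hP k), mul_comm, add_sub_cancel]

theorem range_augPiece (hI : IsHomogeneousIdeal I) (j : ℤ) :
    LinearMap.range (F.augPiece j) = gradedPiece I j := by
  apply le_antisymm
  · rintro _ ⟨v, rfl⟩
    obtain ⟨P, hP, h⟩ := F.exists_aug_lift
    refine ⟨∑ k, v.1 k * P k, ?_, (h v.1).symm⟩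
    rw [SetLike.mem_coe, twistPiece_eq_piece]
    refine Submodule.sum_mem _ fun k _ => ?_
    simpa using mul_mem_piece (mem_strand.1 v.2 k) (hP k)
  · rintro _ ⟨p, hp, rfl⟩
    rw [SetLike.mem_coe, twistPiece_eq_piece, sub_zero] at hp
    exact F.mem_range_augPiece hI hp

theorem ker_augPiece (j : ℤ) : LinearMap.ker (F.augPiece j) = LinearMap.range (F.diff 0 j) := by
  apply le_antisymm
  · intro v hv
    obtain ⟨w, hw⟩ := (F.exact_zero v.1).1 hv
    refine ⟨⟨_, strandProj_mem (F.deg 1) j w⟩, Subtype.ext ?_⟩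
    rw [coe_diff, ← strandProj_mulVec (F.d_mem_piece 0)]
    change strandProj K c _ j ((F.d 0).mulVecLin w) = _
    rw [hw, strandProj_of_mem v.2]
  · rintro _ ⟨v, rfl⟩
    exact F.exact_zero.apply_apply_eq_zero _

theorem relBetti_bot_zero (hI : IsHomogeneousIdeal I) (j : ℤ) :
    F.relBetti ⊥ 0 j = hilbertFunction I j := by
  have h := LinearMap.finrank_range_add_finrank_ker (F.augPiece j)
  rw [range_augPiece F hI, ker_augPiece] at h
  rw [relBetti, relBoundaries, idealPart_bot, bot_sup_eq, relCycles, finrank_top, ← h]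
  exact Nat.add_sub_cancel _ _

/-- The hypothesis says that $(A/JA)_j = 0$, and $H_0(F/JF) = A/JA$. -/
theorem relBetti_zero_eq_zero (hI : IsHomogeneousIdeal I) {J : Ideal (MvPolynomial (Fin c) K)}
    {j : ℤ} (h : ∀ p ∈ piece K c j, ∃ q ∈ J, q ∈ piece K c j ∧ p - q ∈ I) :
    F.relBetti J 0 j = 0 := by
  refine Nat.sub_eq_zero_of_le (Submodule.finrank_mono fun v _ => ?_)
  obtain ⟨w₀, hw₀⟩ := F.mem_range_augPiece hI (j := 0) (p := 1)
    (mem_piece_natCast.2 (isHomogeneous_one _ _))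
  have hv : F.augPiece j v ∈ gradedPiece I j := by
    rw [← F.range_augPiece hI]
    exact ⟨v, rfl⟩
  obtain ⟨p, hp, hpv⟩ := hv
  rw [SetLike.mem_coe, twistPiece_eq_piece, sub_zero] at hp
  obtain ⟨q, hqJ, hq, hpq⟩ := h p hp
  -- Since $w_0$ lifts $1 \in A$, the multiple $qw_0$ lies in $JF_0$ and lifts the class of $q$.
  let w : F.V 0 j := ⟨q • w₀.1, by simpa using smul_mem_strand hq w₀.2⟩
  have hw : w ∈ F.idealPart J 0 j := fun k => J.mul_mem_right _ hqJ
  have hker : v - w ∈ LinearMap.range (F.diff 0 j) := by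
    rw [← ker_augPiece, LinearMap.mem_ker, map_sub, sub_eq_zero, ← hpv]
    change _ = Fintype.linearCombination (MvPolynomial (Fin c) K) F.aug (q • w₀.1)
    change Fintype.linearCombination (MvPolynomial (Fin c) K) F.aug w₀.1 = _ at hw₀
    rw [map_smul, hw₀]
    change Ideal.Quotient.mk I p = Ideal.Quotient.mk I (q * 1)
    rw [mul_one]
    exact Ideal.Quotient.eq.2 hpq
  rw [← sub_add_cancel v w]
  exact Submodule.add_mem _ (Submodule.mem_sup_right hker) (Submodule.mem_sup_left hw)

/-! ### Reduction modulo the variables -/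

/-- The reduction of the degree `j` part of `F_i` modulo the variables. -/
def reduction (i : ℕ) (j : ℤ) : F.V i j →ₗ[K] (Fin (F.rank i) → K) :=
  ((MvPolynomial.lcoeff K 0).compLeft (Fin (F.rank i))).domRestrict _

theorem reduction_apply (i : ℕ) (j : ℤ) (v : F.V i j) (k : Fin (F.rank i)) :
    F.reduction i j v k = constantCoeff (v.1 k) := rfl

theorem ker_reduction (i : ℕ) (j : ℤ) :
    LinearMap.ker (F.reduction i j) =
      F.idealPart (RingHom.ker (constantCoeff (R := K) (σ := Fin c))) i j := by
  ext v
  rw [LinearMap.mem_ker, mem_idealPart, funext_iff]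
  rfl

theorem redDiff_reduction (i : ℕ) (j : ℤ) (v : F.V (i + 1) j) :
    F.redDiff i (F.reduction (i + 1) j v) = F.reduction i j (F.diff i j v) := by
  funext k
  rw [reduction_apply, coe_diff, RingHom.map_mulVec]
  rfl

theorem range_reduction (i : ℕ) (j : ℤ) :
    LinearMap.range (F.reduction i j) = F.redPiece i j := by
  classical
  apply le_antisymm
  · rintro _ ⟨v, rfl⟩
    rw [pi_eq_sum_univ' (F.reduction i j v)]
    refine Submodule.sum_mem _ fun k _ => ?_
    by_cases hk : F.deg i k = j
    · refine Submodule.smul_mem _ _ (Submodule.subset_span ⟨k, hk, ?_⟩)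
      rfl
    · rw [reduction_apply]
      have h := pieceProj_of_mem_of_ne (mem_strand.1 v.2 k) (n := 0) (by omega)
      have h' : constantCoeff (v.1 k) = 0 := by
        rw [pieceProj, if_pos le_rfl, Int.toNat_zero, homogeneousComponent_zero] at h
        rwa [C_eq_zero] at h
      rw [h', zero_smul]
      exact Submodule.zero_mem _
  · refine Submodule.span_le.2 ?_
    rintro _ ⟨k, hk, rfl⟩
    refine ⟨⟨Pi.single k 1, mem_strand.2 fun l => ?_⟩, ?_⟩
    · by_cases hl : l = k
      · subst hl
        rw [Pi.single_eq_same, hk, sub_self]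
        exact mem_piece_natCast.2 (isHomogeneous_one _ _)
      · rw [Pi.single_eq_of_ne hl]
        exact Submodule.zero_mem _
    · funext l
      rw [reduction_apply]
      by_cases hl : l = k
      · subst hl
        simp
      · simp [Pi.single_eq_of_ne hl]

theorem map_reduction_relCycles (i : ℕ) (j : ℤ) :
    (F.relCycles (RingHom.ker (constantCoeff (R := K) (σ := Fin c))) i j).map (F.reduction i j) =
      F.cycles i j := by
  rw [cycles, ← range_reduction]
  cases i with
  | zero => rw [relCycles, redKer, top_inf_eq, Submodule.map_top]
  | succ i =>
    rw [relCycles, redKer, ← ker_reduction]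
    ext w
    constructor
    · rintro ⟨v, hv, rfl⟩
      refine ⟨?_, v, rfl⟩
      rw [SetLike.mem_coe, LinearMap.mem_ker, redDiff_reduction]
      exact hv
    · rintro ⟨hw, v, rfl⟩
      rw [SetLike.mem_coe, LinearMap.mem_ker, redDiff_reduction] at hw
      exact ⟨v, hw, rfl⟩

theorem map_reduction_relBoundaries (i : ℕ) (j : ℤ) :
    (F.relBoundaries (RingHom.ker (constantCoeff (R := K) (σ := Fin c))) i j).map
      (F.reduction i j) = F.boundaries i j := by
  rw [boundaries, ← range_reduction, relBoundaries, Submodule.map_sup, ← ker_reduction,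
    LinearMap.le_ker_iff_map.1 le_rfl, bot_sup_eq, ← LinearMap.range_comp,
    ← LinearMap.range_comp]
  exact congrArg _ (LinearMap.ext fun v => (F.redDiff_reduction i j v).symm)

/-- Cycles and boundaries modulo the maximal ideal $M$ both contain $MF_i$, the kernel of reduction,
so reducing lowers both dimensions equally. -/
theorem bettiNumber_eq_relBetti (i : ℕ) (j : ℤ) :
    F.bettiNumber i j = F.relBetti (RingHom.ker (constantCoeff (R := K) (σ := Fin c))) i j := by
  set M := RingHom.ker (constantCoeff (R := K) (σ := Fin c)) with hM
  have hle : F.boundaries i j ≤ F.cycles i j := by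
    rw [← map_reduction_relCycles, ← map_reduction_relBoundaries]
    exact Submodule.map_mono (F.relBoundaries_le_relCycles _ i j)
  have hker := F.ker_reduction i j
  rw [← hM] at hker
  have h1 : Module.finrank K (F.cycles i j) + Module.finrank K (F.idealPart M i j) =
      Module.finrank K (F.relCycles M i j) := by
    rw [← map_reduction_relCycles, ← hker]
    exact finrank_map_add_finrank_ker _ (hker.trans_le (F.idealPart_le_relCycles M i j))
  have h2 : Module.finrank K (F.boundaries i j) + Module.finrank K (F.idealPart M i j) =
      Module.finrank K (F.relBoundaries M i j) := by
    rw [← map_reduction_relBoundaries, ← hker]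
    exact finrank_map_add_finrank_ker _ (hker.trans_le le_sup_left)
  have h3 := F.relBetti_add M i j
  have h4 := Submodule.finrank_quotient_add_finrank
    ((F.boundaries i j).submoduleOf (F.cycles i j))
  rw [(Submodule.submoduleOfEquivOfLe hle).finrank_eq] at h4
  rw [bettiNumber]
  omega

end GradedFreeResolution

/-! ### The numerical recurrence -/

section Recurrence

variable {c e : ℕ} {t s : ℕ → ℕ → ℤ → ℕ}

/-- Row zero is the Hilbert function of $A/J_kA$. It never increases with $k$, and its degree 1
entry drops by at most one per step, since degree 0 is one-dimensional. Falling from $c$ to $0$ in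
$c$ steps, it drops by exactly one each time. -/
theorem recurrence_row_zero
    (hzero : ∀ k < c, ∀ j, t (k + 1) 0 (j + 1) + t k 0 j = t k 0 (j + 1) + s k 0 j)
    (hs : ∀ k < c, ∀ i j, s k i j ≤ t k i j)
    (h0 : t 0 0 0 = 1) (h1 : t 0 0 1 = c) (hneg : ∀ j < 0, t 0 0 j = 0)
    (hone : ∀ j, 2 ≤ j → t 1 0 j = 0) (hlast : t c 0 1 = 0) {k : ℕ} (hk : 1 ≤ k) (hkc : k ≤ c)
    (j : ℤ) :
    (t k 0 j : ℤ) = if j = 0 then 1 else if j = 1 then (c : ℤ) - k else 0 := by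
  have mono : ∀ k < c, ∀ j, t (k + 1) 0 j ≤ t k 0 j := fun k hk j => by
    have h1 := hzero k hk (j - 1)
    have h2 := hs k hk 0 (j - 1)
    rw [sub_add_cancel] at h1
    omega
  have neg : ∀ k ≤ c, ∀ j < 0, t k 0 j = 0 := fun k => by
    induction k with
    | zero => exact fun _ => hneg
    | succ k ih => exact fun hk j hj =>
        Nat.le_zero.1 ((mono k hk j).trans (ih (Nat.le_of_succ_le hk) j hj).le)
  have zero : ∀ k ≤ c, t k 0 0 = 1 := fun k => by
    induction k with
    | zero => exact fun _ => h0
    | succ k ih =>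
      intro hk
      have h1 := hzero k hk (-1)
      have h2 := hs k hk 0 (-1)
      have h3 := neg k (by omega) (-1) (by omega)
      have h4 := ih (by omega)
      rw [neg_add_cancel] at h1
      omega
  have drop : ∀ k < c, t k 0 1 ≤ t (k + 1) 0 1 + 1 := fun k hk => by
    have h1 := hzero k hk 0
    have h2 := zero k hk.le
    rw [zero_add] at h1
    omega
  have one_ge : ∀ k ≤ c, c ≤ t k 0 1 + k := fun k => by
    induction k with
    | zero => exact fun _ => h1.ge
    | succ k ih =>
      intro hk
      have h1 := drop k hk
      have h2 := ih (by omega)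
      omega
  -- Counted backwards from the end of the flag, where the entry is zero.
  have one_le : ∀ m ≤ c, t (c - m) 0 1 ≤ m := fun m => by
    induction m with
    | zero => exact fun _ => hlast.le
    | succ m ih =>
      intro hm
      have h1 := drop (c - (m + 1)) (by omega)
      have h2 := ih (by omega)
      rw [show c - (m + 1) + 1 = c - m by omega] at h1
      omega
  have two : ∀ k, k + 1 ≤ c → ∀ j, 2 ≤ j → t (k + 1) 0 j = 0 := fun k => by
    induction k with
    | zero => exact fun _ => hone
    | succ k ih => exact fun hkc j hj =>
        Nat.le_zero.1 ((mono (k + 1) hkc j).trans (ih (Nat.le_of_succ_le hkc) j hj).le)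
  split_ifs with hj0 hj1
  · subst hj0
    exact_mod_cast zero k hkc
  · subst hj1
    have h1 := one_ge k hkc
    have h2 := one_le (c - k) (by omega)
    rw [show c - (c - k) = k by omega] at h2
    omega
  · rcases lt_or_ge j 0 with hj | hj
    · exact_mod_cast neg k hkc j hj
    · obtain ⟨k, rfl⟩ := Nat.exists_eq_add_of_le' hk
      exact_mod_cast two k hkc j (by omega)

theorem recurrence_row_succ (hc : 1 ≤ c) (he : 3 ≤ e)
    (hsucc : ∀ k < c, ∀ i j, t (k + 1) (i + 1) (j + 1) + t k (i + 1) j =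
      t k (i + 1) (j + 1) + s k (i + 1) j + s k i j)
    (hzero : ∀ k < c, ∀ j, t (k + 1) 0 (j + 1) + t k 0 j = t k 0 (j + 1) + s k 0 j)
    (hs : ∀ k < c, ∀ i j, s k i j ≤ t k i j)
    (ht : ∀ k < c, ∀ i j, t k i j ≤ s k i j + t k i (j + 1))
    (h0 : t 0 0 0 = 1) (h1 : t 0 0 1 = c) (h2 : ∀ j : ℤ, 2 ≤ j → j ≤ e → t 0 0 j = 1)
    (hneg : ∀ j < 0, t 0 0 j = 0) (hgt : ∀ j > (e : ℤ), t 0 0 j = 0)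
    (hacyclic : ∀ i j, t 0 (i + 1) j = 0)
    (hone : ∀ j, 2 ≤ j → t 1 0 j = 0) (hlast : t c 0 1 = 0) {k : ℕ} (hkc : k + 1 ≤ c)
    (i : ℕ) (j : ℤ) :
    (t (k + 1) (i + 1) j : ℤ) = if j = e + i + 1 then (k.choose i : ℤ) else if j = i + 2 then
      (c : ℤ) * (k + 1).choose (i + 1) - (k + 1).choose (i + 2) - k.choose i else 0 := by
  have row {k : ℕ} (hk : 1 ≤ k) (hkc : k ≤ c) (j : ℤ) :=
    recurrence_row_zero hzero hs h0 h1 hneg hone hlast hk hkc j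
  induction k generalizing i j with
  | zero =>
    have a1 := hsucc 0 hkc i (j - 1)
    have a2 := hs 0 hkc (i + 1) (j - 1)
    rw [sub_add_cancel, hacyclic, hacyclic] at a1
    rw [hacyclic] at a2
    -- By acyclicity $t_1(i+1,j) = s_0(i,j-1)$. For $i=0$ this kernel is read off from the row zero
    -- recurrence, and for $i>0$ it vanishes.
    cases i with
    | zero =>
      have a3 := hzero 0 hkc (j - 1)
      have a4 := row le_rfl hc j
      rw [sub_add_cancel] at a3
      rcases lt_trichotomy j 1 with hj | rfl | hj
      · have b1 := hneg (j - 1) (by omega)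
        have b2 := hs 0 hkc 0 (j - 1)
        rw [if_neg (by push_cast; omega), if_neg (by push_cast; omega)]
        simp only [zero_add] at *
        omega
      · rw [if_neg one_ne_zero, if_pos rfl] at a4
        rw [if_neg (by push_cast; omega), if_neg (by norm_num)]
        simp only [zero_add, sub_self] at *
        omega
      · rw [if_neg (by omega), if_neg (by omega)] at a4
        rcases lt_trichotomy j 2 with hj' | rfl | hj'
        · omega
        · have b1 := h2 2 le_rfl (by omega)
          rw [if_neg (by push_cast; omega), if_pos (by simp)]
          simp only [zero_add, show (2 : ℤ) - 1 = 1 by norm_num] at *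
          simp
          omega
        · rcases lt_trichotomy j (e + 1) with hj'' | rfl | hj''
          · have b1 := h2 j (by omega) (by omega)
            have b2 := h2 (j - 1) (by omega) (by omega)
            rw [if_neg (by push_cast; omega), if_neg (by push_cast; omega)]
            simp only [zero_add] at *
            omega
          · have b1 := h2 e (by omega) le_rfl
            have b2 := hgt (e + 1) (by omega)
            rw [if_pos (by simp)]
            simp only [zero_add, add_sub_cancel_right] at *
            simp
            omega
          · have b1 := hgt j (by omega)
            have b2 := hgt (j - 1) (by omega)
            rw [if_neg (by push_cast; omega), if_neg (by push_cast; omega)]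
            simp only [zero_add] at *
            omega
    | succ i =>
      have a3 := hs 0 hkc (i + 1) (j - 1)
      rw [hacyclic] at a3
      simp [Nat.choose_eq_zero_of_lt]
      simp only [zero_add] at *
      omega
  | succ k ih =>
    have hk : k + 1 < c := hkc
    specialize ih hk.le
    -- The two degrees carrying row $i+1$ differ by $e-1 \ge 2$, so of two consecutive entries one
    -- is zero; hence multiplication by the next form is zero.
    have full (i : ℕ) (j : ℤ) : s (k + 1) (i + 1) j = t (k + 1) (i + 1) j := by
      have a1 := hs (k + 1) hk (i + 1) j
      have a2 := ht (k + 1) hk (i + 1) j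
      have a3 := ih i j
      have a4 := ih i (j + 1)
      split_ifs at a3 a4 <;> omega
    have a1 := hsucc (k + 1) hk i (j - 1)
    rw [sub_add_cancel, full] at a1
    have a2 := ih i j
    cases i with
    | zero =>
      -- `full` does not cover row zero, where multiplication from degree 0 to degree 1 is
      -- injective. The kernel fed in from there comes from the known row zero entries instead.
      have a3 := hzero (k + 1) hk (j - 1)
      have a4 := row (k := k + 1) (by omega) hk.le j
      have a5 := row (k := k + 1) (by omega) hk.le (j - 1)
      have a6 := row (k := k + 2) (by omega) hkc j
      rw [sub_add_cancel] at a3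
      have p1 : (((k + 2).choose 2 : ℕ) : ℤ) = (k + 1).choose 2 + (k + 1) := by
        rw [Nat.choose_succ_succ' (k + 1) 1]
        push_cast [Nat.choose_one_right]
        ring
      simp only [zero_add, Nat.choose_zero_right, Nat.choose_one_right, add_assoc, Nat.reduceAdd,
        Nat.cast_zero, p1] at *
      have p2 : (c : ℤ) * ((k + 2 : ℕ) : ℤ) = c * ((k + 1 : ℕ) : ℤ) + c := by
        push_cast
        ring
      rw [p2]
      push_cast at *
      split_ifs at * <;> omega
    | succ i =>
      -- Here the recurrence reads $t_{k+2}(i+2,j) = t_{k+1}(i+2,j) + t_{k+1}(i+1,j-1)$, which is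
      -- Pascal's rule for each binomial in the formula.
      have a3 := ih i (j - 1)
      rw [full] at a1
      have p1 := Nat.choose_succ_succ' k i
      have p2 := Nat.choose_succ_succ' (k + 1) (i + 1)
      have p3 := Nat.choose_succ_succ' (k + 1) (i + 2)
      have p4 : (c : ℤ) * ((k + 2).choose (i + 2) : ℕ) =
          c * ((k + 1).choose (i + 1) : ℕ) + c * ((k + 1).choose (i + 2) : ℕ) := by
        rw [p2]
        push_cast
        ring
      simp only [add_assoc, Nat.reduceAdd] at *
      rw [p4]
      push_cast at *
      split_ifs at * <;> omega

end Recurrence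

/-! ### Existence of graded free resolutions -/

section Existence

variable {K : Type*} [Field K] {c : ℕ}

theorem pieceProj_eq_zero_of_notMem {n : ℤ} {p : MvPolynomial (Fin c) K}
    (hn : n ∉ (Finset.range (p.totalDegree + 1)).image ((↑) : ℕ → ℤ)) :
    pieceProj K c n p = 0 := by
  rcases lt_or_ge n 0 with h | h
  · rw [pieceProj, if_neg h.not_ge, LinearMap.zero_apply]
  · lift n to ℕ using h
    have : p.totalDegree < n := by
      by_contra! h
      exact hn (Finset.mem_image_of_mem _ (Finset.mem_range.2 (Nat.lt_succ_of_le h)))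
    simpa [pieceProj] using homogeneousComponent_eq_zero n p this

theorem sum_pieceProj {p : MvPolynomial (Fin c) K} {s : Finset ℤ}
    (hs : (Finset.range (p.totalDegree + 1)).image ((↑) : ℕ → ℤ) ⊆ s) :
    ∑ n ∈ s, pieceProj K c n p = p := by
  rw [← Finset.sum_subset hs fun n _ hn => pieceProj_eq_zero_of_notMem hn,
    Finset.sum_image fun _ _ _ _ h => Nat.cast_injective h]
  simpa [pieceProj] using sum_homogeneousComponent p

theorem exists_sum_strandProj {ι : Type*} [Fintype ι] (a : ι → ℤ)
    (v : ι → MvPolynomial (Fin c) K) :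
    ∃ s : Finset ℤ, ∑ j ∈ s, strandProj K c a j v = v := by
  classical
  refine ⟨Finset.univ.biUnion fun k =>
    ((Finset.range ((v k).totalDegree + 1)).image ((↑) : ℕ → ℤ)).image (· + a k), funext fun k => ?_⟩
  rw [Finset.sum_apply]
  simp only [strandProj_apply]
  rw [← Finset.sum_image (s := Finset.biUnion _ _) (g := fun j => j - a k)
    (f := fun n => pieceProj K c n (v k)) fun _ _ _ _ h => sub_left_injective h]
  refine sum_pieceProj fun n hn => Finset.mem_image.2 ⟨n + a k, ?_, add_sub_cancel_right _ _⟩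
  exact Finset.mem_biUnion.2 ⟨k, Finset.mem_univ _, Finset.mem_image_of_mem _ hn⟩

/-- A graded submodule of a graded free module of finite rank. -/
structure GradedSubmodule (K : Type*) [Field K] (c : ℕ) where
  /-- the rank of the ambient free module -/
  rank : ℕ
  /-- the degrees of the basis vectors -/
  deg : Fin rank → ℤ
  /-- the submodule -/
  carrier : Submodule (MvPolynomial (Fin c) K) (Fin rank → MvPolynomial (Fin c) K)
  strandProj_mem : ∀ v ∈ carrier, ∀ j, strandProj K c deg j v ∈ carrier

/-- Components of elements stay in the submodule, so homogeneous elements generate it; noetherianity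
selects finitely many of them. -/
theorem GradedSubmodule.exists_cover (P : GradedSubmodule K c) :
    ∃ (m : ℕ) (b : Fin m → ℤ) (D : Matrix (Fin P.rank) (Fin m) (MvPolynomial (Fin c) K)),
      (∀ k l, D k l ∈ piece K c (b l - P.deg k)) ∧ LinearMap.range D.mulVecLin = P.carrier := by
  let H := {w | w ∈ P.carrier ∧ ∃ j, w ∈ strand K c P.deg j}
  have hH : Submodule.span (MvPolynomial (Fin c) K) H = P.carrier := by
    refine le_antisymm (Submodule.span_le.2 fun w hw => hw.1) fun v hv => ?_
    obtain ⟨s, hs⟩ := exists_sum_strandProj P.deg v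
    rw [← hs]
    exact Submodule.sum_mem _ fun j _ => Submodule.subset_span
      ⟨P.strandProj_mem v hv j, j, BettiOfHVector.strandProj_mem _ _ _⟩
  obtain ⟨T, hTH, hT⟩ := (Submodule.fg_span_iff_fg_span_finset_subset H).1
    (IsNoetherian.noetherian (Submodule.span (MvPolynomial (Fin c) K) H))
  have hdeg : ∀ w : T, ∃ j, w.1 ∈ strand K c P.deg j := fun w => (hTH w.2).2
  choose b hb using hdeg
  let σ := T.equivFin
  refine ⟨T.card, fun l => b (σ.symm l), Matrix.of fun k l => (σ.symm l).1 k,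
    fun k l => mem_strand.1 (hb _) k, ?_⟩
  rw [Matrix.range_mulVecLin, ← hH, hT]
  congr 1
  ext w
  constructor
  · rintro ⟨l, rfl⟩
    exact (σ.symm l).2
  · intro hw
    refine ⟨σ ⟨w, hw⟩, funext fun k => ?_⟩
    simp [Matrix.col]

/-- The kernel of a homogeneous matrix as a graded submodule. -/
def GradedSubmodule.ker {m n : ℕ} (a : Fin m → ℤ) (b : Fin n → ℤ)
    (D : Matrix (Fin m) (Fin n) (MvPolynomial (Fin c) K))
    (hD : ∀ k l, D k l ∈ piece K c (b l - a k)) : GradedSubmodule K c where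
  rank := n
  deg := b
  carrier := LinearMap.ker D.mulVecLin
  strandProj_mem v hv j := by
    rw [LinearMap.mem_ker, Matrix.mulVecLin_apply] at hv ⊢
    rw [← strandProj_mulVec hD, hv, map_zero]

/-- The graded submodule of relations of a chosen finite system of homogeneous generators. -/
def GradedSubmodule.syzygies (P : GradedSubmodule K c) : GradedSubmodule K c :=
  .ker P.deg P.exists_cover.choose_spec.choose P.exists_cover.choose_spec.choose_spec.choose
    P.exists_cover.choose_spec.choose_spec.choose_spec.1

/-- The matrix of a chosen finite system of homogeneous generators. -/
def GradedSubmodule.generators (P : GradedSubmodule K c) :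
    Matrix (Fin P.rank) (Fin P.syzygies.rank) (MvPolynomial (Fin c) K) :=
  P.exists_cover.choose_spec.choose_spec.choose

theorem GradedSubmodule.generators_mem (P : GradedSubmodule K c) (k : Fin P.rank)
    (l : Fin P.syzygies.rank) : P.generators k l ∈ piece K c (P.syzygies.deg l - P.deg k) :=
  P.exists_cover.choose_spec.choose_spec.choose_spec.1 k l

theorem GradedSubmodule.range_generators (P : GradedSubmodule K c) :
    LinearMap.range P.generators.mulVecLin = P.carrier :=
  P.exists_cover.choose_spec.choose_spec.choose_spec.2

theorem GradedSubmodule.ker_generators (P : GradedSubmodule K c) :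
    LinearMap.ker P.generators.mulVecLin = P.syzygies.carrier := rfl

/-- The iterated syzygies of a graded submodule. -/
def GradedSubmodule.iterSyzygies (P : GradedSubmodule K c) : ℕ → GradedSubmodule K c
  | 0 => P
  | i + 1 => (P.iterSyzygies i).syzygies

/-- A homogeneous ideal as a graded submodule of the free module of rank one. -/
def GradedSubmodule.ofIdeal (I : Ideal (MvPolynomial (Fin c) K)) (hI : IsHomogeneousIdeal I) :
    GradedSubmodule K c where
  rank := 1
  deg := 0
  carrier := Submodule.comap (LinearMap.proj 0) I
  strandProj_mem _ hv _ := hI.pieceProj_mem hv _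

theorem nonempty_gradedFreeResolution {I : Ideal (MvPolynomial (Fin c) K)}
    (hI : IsHomogeneousIdeal I) : Nonempty (GradedFreeResolution I) := by
  let P := (GradedSubmodule.ofIdeal I hI).iterSyzygies
  have haug : ∀ v : Fin 1 → MvPolynomial (Fin c) K,
      Fintype.linearCombination (MvPolynomial (Fin c) K)
        (fun _ => (1 : MvPolynomial (Fin c) K ⧸ I)) v = Ideal.Quotient.mk I (v 0) := fun v => by
    rw [Fintype.linearCombination_apply, Fin.sum_univ_one]
    exact congrArg (Ideal.Quotient.mk I) (mul_one (v 0))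
  exact ⟨{
    rank := fun i => (P i).rank
    deg := fun i => (P i).deg
    d := fun i => (P i).generators
    aug := fun _ => 1
    d_homogeneous := fun i => (P i).generators_mem
    aug_homogeneous := fun _ =>
      ⟨1, mem_piece_natCast (n := 0).2 (isHomogeneous_one _ _), rfl⟩
    exact_succ := fun i => LinearMap.exact_iff.2
      ((P i).ker_generators.trans (P (i + 1)).range_generators.symm)
    exact_zero := fun v => by
      refine Iff.trans ?_ (SetLike.ext_iff.1 (P 0).range_generators v).symm
      exact (Eq.congr_left (haug v)).trans Ideal.Quotient.eq_zero_iff_mem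
    aug_surjective := fun x => by
      obtain ⟨p, rfl⟩ := Ideal.Quotient.mk_surjective x
      exact ⟨fun _ => p, haug _⟩ }⟩

end Existence

/-! ### Linear changes of coordinates -/

section LinearSubst

variable {K : Type*} [Field K] {c : ℕ}

@[simp]
theorem linearSubst_X (g : Matrix (Fin c) (Fin c) K) (i : Fin c) :
    linearSubst g (X i) = ∑ j, C (g i j) * X j :=
  aeval_X _ _

/-- Substitution reverses composition, which fixes the roles of `g` and `h` below. -/
theorem linearSubst_linearSubst (g h : Matrix (Fin c) (Fin c) K) (p : MvPolynomial (Fin c) K) :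
    linearSubst h (linearSubst g p) = linearSubst (g * h) p := by
  rw [← AlgHom.comp_apply]
  congr 1
  refine algHom_ext fun i => ?_
  rw [AlgHom.comp_apply, linearSubst_X, linearSubst_X, map_sum]
  simp only [map_mul, algHom_C, linearSubst_X, Finset.mul_sum, Matrix.mul_apply, map_sum,
    Finset.sum_mul]
  rw [Finset.sum_comm]
  simp [algebraMap_eq, mul_assoc]

theorem linearSubst_one (p : MvPolynomial (Fin c) K) : linearSubst (1 : Matrix _ _ K) p = p := by
  have : linearSubst (1 : Matrix (Fin c) (Fin c) K) = AlgHom.id K _ := by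
    refine algHom_ext fun i => ?_
    simp [Matrix.one_apply]
  rw [this, AlgHom.id_apply]

theorem isHomogeneous_linearSubst (g : Matrix (Fin c) (Fin c) K) {n : ℕ}
    {p : MvPolynomial (Fin c) K} (hp : p.IsHomogeneous n) : (linearSubst g p).IsHomogeneous n := by
  have := hp.aeval (fun i => ∑ j, C (g i j) * X j) (n := 1) fun i =>
    IsHomogeneous.sum _ _ _ fun j _ => isHomogeneous_C_mul_X _ _
  rwa [one_mul] at this

theorem homogeneousComponent_linearSubst (g : Matrix (Fin c) (Fin c) K) (n : ℕ)
    (p : MvPolynomial (Fin c) K) :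
    homogeneousComponent n (linearSubst g p) = linearSubst g (homogeneousComponent n p) := by
  induction p using MvPolynomial.induction_on' with
  | monomial d a =>
    have hd := isHomogeneous_monomial a (rfl : d.degree = d.degree)
    rw [homogeneousComponent_of_mem hd,
      homogeneousComponent_of_mem (isHomogeneous_linearSubst g hd)]
    split_ifs <;> simp
  | add p q hp hq => rw [map_add, map_add, map_add, map_add, hp, hq]

theorem constantCoeff_linearSubst (g : Matrix (Fin c) (Fin c) K) (p : MvPolynomial (Fin c) K) :
    constantCoeff (linearSubst g p) = constantCoeff p := by
  have h := homogeneousComponent_linearSubst g 0 p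
  rw [homogeneousComponent_zero, homogeneousComponent_zero, algHom_C, algebraMap_eq] at h
  exact C_injective _ _ h

/-- An isomorphism between two lines extends to an automorphism of $K^c$. -/
theorem exists_matrix_mulVec_eq {lam : Fin c → K} (hlam : lam ≠ 0) (i : Fin c) :
    ∃ g h : Matrix (Fin c) (Fin c) K, g * h = 1 ∧ h * g = 1 ∧ h.mulVec lam = Pi.single i 1 := by
  have he : (Pi.single i 1 : Fin c → K) ≠ 0 := by simp
  let f := (LinearEquiv.toSpanNonzeroSingleton K _ lam hlam).symm ≪≫ₗ
    LinearEquiv.toSpanNonzeroSingleton K _ _ he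
  obtain ⟨u, hu⟩ := Submodule.exists_linearEquiv_restrict_eq f
  have h1 := hu ⟨lam, Submodule.mem_span_singleton_self lam⟩
  refine ⟨LinearMap.toMatrix' u.symm.toLinearMap, LinearMap.toMatrix' u.toLinearMap, ?_, ?_, ?_⟩
  · rw [← LinearMap.toMatrix'_comp]
    simp
  · rw [← LinearMap.toMatrix'_comp]
    simp
  · rw [LinearMap.toMatrix'_mulVec]
    refine h1.symm.trans ?_
    have : (⟨lam, Submodule.mem_span_singleton_self lam⟩ : Submodule.span K {lam}) =
        LinearEquiv.toSpanNonzeroSingleton K _ lam hlam 1 := Subtype.ext (one_smul K lam).symm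
    rw [LinearEquiv.trans_apply, this, LinearEquiv.symm_apply_apply]
    exact one_smul K _

end LinearSubst

/-! ### Ideals generated by linear forms -/

section CoordinateIdeals

/-- The index of the coordinate added at the `k`-th step of the flag. -/
def flagIndex (c k : ℕ) (hk : k < c) : Fin c := ⟨c - 1 - k, by omega⟩

variable {K : Type*} [Field K] {c : ℕ}

theorem isHomogeneousIdeal_span_X (s : Set (Fin c)) :
    IsHomogeneousIdeal (Ideal.span (X '' s : Set (MvPolynomial (Fin c) K))) := by
  intro p hp n
  rw [mem_ideal_span_X_image] at hp ⊢
  intro m hm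
  refine hp m ?_
  rw [mem_support_iff, coeff_homogeneousComponent] at hm
  rw [mem_support_iff]
  exact fun h => hm (by simp [h])

/-- Membership is tested on monomials, and a factor $x_i$ with $i \notin s$ contributes no variable
from $s$. This is the regularity of the flag. -/
theorem mem_span_X_of_X_mul_mem {s : Set (Fin c)} {i : Fin c} (hi : i ∉ s)
    {p : MvPolynomial (Fin c) K} (h : X i * p ∈ Ideal.span (X '' s)) :
    p ∈ Ideal.span (X '' s) := by
  rw [mem_ideal_span_X_image] at h ⊢
  intro m hm
  obtain ⟨j, hj, hmj⟩ := h (Finsupp.single i 1 + m) (by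
    rw [mem_support_iff, coeff_X_mul]
    exact mem_support_iff.1 hm)
  refine ⟨j, hj, ?_⟩
  have : i ≠ j := fun h => hi (h ▸ hj)
  simpa [Finsupp.single_apply, this] using hmj

theorem mem_span_X_iff_constantCoeff {p : MvPolynomial (Fin c) K} :
    p ∈ Ideal.span (X '' (Set.univ : Set (Fin c))) ↔ constantCoeff p = 0 := by
  rw [mem_ideal_span_X_image, constantCoeff_eq, ← notMem_support_iff]
  refine ⟨fun h h0 => by simpa using h 0 h0, fun h m hm => ?_⟩
  by_contra! hm'
  have : m = 0 := Finsupp.ext fun i => hm' i (Set.mem_univ i)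
  exact h (this ▸ hm)

/-- The set of the last `k` indices. -/
def lastIndices (c k : ℕ) : Set (Fin c) := {i | c ≤ i + k}

/-- The ideal generated by the last `k` coordinates after a linear change of coordinates. -/
def flagIdeal (g : Matrix (Fin c) (Fin c) K) (k : ℕ) : Ideal (MvPolynomial (Fin c) K) :=
  (Ideal.span (X '' lastIndices c k)).comap (linearSubst g)

theorem mem_flagIdeal {g : Matrix (Fin c) (Fin c) K} {k : ℕ} {p : MvPolynomial (Fin c) K} :
    p ∈ flagIdeal g k ↔ linearSubst g p ∈ Ideal.span (X '' lastIndices c k) := Iff.rfl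

theorem isHomogeneousIdeal_flagIdeal (g : Matrix (Fin c) (Fin c) K) (k : ℕ) :
    IsHomogeneousIdeal (flagIdeal g k) := by
  intro p hp n
  rw [mem_flagIdeal, ← homogeneousComponent_linearSubst]
  exact isHomogeneousIdeal_span_X _ _ hp n

theorem flagIdeal_card (g : Matrix (Fin c) (Fin c) K) :
    flagIdeal g c = RingHom.ker (constantCoeff (R := K) (σ := Fin c)) := by
  have h : lastIndices c c = Set.univ := by
    ext
    simp [lastIndices]
  ext p
  rw [mem_flagIdeal, h, mem_span_X_iff_constantCoeff, constantCoeff_linearSubst, RingHom.mem_ker]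

variable {g h : Matrix (Fin c) (Fin c) K}

theorem flagIdeal_zero (hgh : g * h = 1) : flagIdeal g 0 = ⊥ := by
  have hs : lastIndices c 0 = ∅ := by
    ext i
    simp [lastIndices, i.2]
  ext p
  rw [mem_flagIdeal, hs, Set.image_empty, Ideal.span_empty, Ideal.mem_bot, Ideal.mem_bot]
  refine ⟨fun hp => ?_, fun hp => by rw [hp, map_zero]⟩
  rw [← linearSubst_one p, ← hgh, ← linearSubst_linearSubst, hp, map_zero]

variable {k : ℕ} (hk : k < c)

theorem linearSubst_linearSubst_of_mul_eq_one (hhg : h * g = 1) (p : MvPolynomial (Fin c) K) :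
    linearSubst g (linearSubst h p) = p := by
  rw [linearSubst_linearSubst, hhg, linearSubst_one]

theorem flagIdeal_succ (hgh : g * h = 1) (hhg : h * g = 1) :
    flagIdeal g (k + 1) =
      flagIdeal g k ⊔ Ideal.span {linearSubst h (X (flagIndex c k hk))} := by
  have hs : lastIndices c (k + 1) = insert (flagIndex c k hk) (lastIndices c k) := by
    ext i
    simp only [lastIndices, flagIndex, Set.mem_ofPred_eq, Set.mem_insert_iff, Fin.ext_iff]
    omega
  apply le_antisymm
  · intro p hp
    rw [mem_flagIdeal, hs, Set.image_insert_eq, Ideal.mem_span_insert] at hp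
    obtain ⟨a, z, hz, hp⟩ := hp
    have hp' : p = linearSubst h z + linearSubst h a * linearSubst h (X (flagIndex c k hk)) := by
      rw [← linearSubst_one p, ← hgh, ← linearSubst_linearSubst, hp, map_add, map_mul, add_comm]
    rw [hp']
    refine Ideal.add_mem _ (Ideal.mem_sup_left ?_)
      (Ideal.mul_mem_left _ _ (Ideal.mem_sup_right (Ideal.mem_span_singleton_self _)))
    rwa [mem_flagIdeal, linearSubst_linearSubst_of_mul_eq_one hhg]
  · refine sup_le (fun p hp => ?_) ((Ideal.span_singleton_le_iff_mem _).2 ?_)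
    · refine Ideal.span_mono (Set.image_mono ?_) hp
      rw [hs]
      exact Set.subset_insert _ _
    · rw [mem_flagIdeal, linearSubst_linearSubst_of_mul_eq_one hhg, hs]
      exact Ideal.subset_span (Set.mem_image_of_mem _ (Set.mem_insert _ _))

theorem mem_flagIdeal_of_mul_mem (hhg : h * g = 1) {p : MvPolynomial (Fin c) K}
    (hp : linearSubst h (X (flagIndex c k hk)) * p ∈ flagIdeal g k) : p ∈ flagIdeal g k := by
  rw [mem_flagIdeal, map_mul, linearSubst_linearSubst_of_mul_eq_one hhg] at hp
  refine mem_span_X_of_X_mul_mem ?_ hp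
  simp only [lastIndices, flagIndex, Set.mem_ofPred_eq]
  omega

end CoordinateIdeals

/-! ### The normal form -/

section NormalForm

variable {K : Type*} [Field K] {c e : ℕ} {last : Fin c}

theorem X_mul_X_mem_normalFormIdeal (hlast : (last : ℕ) + 1 = c) {i : Fin c} (hi : i ≠ last)
    (j : Fin c) : (X i * X j : MvPolynomial (Fin c) K) ∈ normalFormIdeal K c e := by
  refine Ideal.subset_span (Or.inr ⟨i, j, fun h => hi (Fin.ext ?_), rfl⟩)
  omega

theorem X_pow_mem_normalFormIdeal (hlast : (last : ℕ) + 1 = c) {n : ℕ} (hn : e < n) :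
    (X last ^ n : MvPolynomial (Fin c) K) ∈ normalFormIdeal K c e :=
  Ideal.mem_of_dvd _ (pow_dvd_pow _ hn) (Ideal.subset_span (Or.inl ⟨last, hlast, rfl⟩))

theorem normalFormIdeal_le {J : Ideal (MvPolynomial (Fin c) K)} (hlast : (last : ℕ) + 1 = c)
    (hpow : X last ^ (e + 1) ∈ J) (hmul : ∀ i ≠ last, ∀ j, X i * X j ∈ J) :
    normalFormIdeal K c e ≤ J := by
  refine Ideal.span_le.2 ?_
  rintro _ (⟨i, hi, rfl⟩ | ⟨i, j, hij, rfl⟩)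
  · rwa [show i = last from Fin.ext (by omega)]
  · by_cases hi : i = last
    · rw [mul_comm]
      exact hmul j (fun hj => hij ⟨by rw [hi, hlast], by rw [hj, hlast]⟩) i
    · exact hmul i hi j

theorem exists_sub_mem_normalFormIdeal (hlast : (last : ℕ) + 1 = c) {n : ℕ} (hn : 2 ≤ n)
    {p : MvPolynomial (Fin c) K} (hp : p.IsHomogeneous n) :
    ∃ a : K, p - C a * X last ^ n ∈ normalFormIdeal K c e := by
  have key : p ∈ (normalFormIdeal K c e).restrictScalars K ⊔
      Submodule.span K {(X last ^ n : MvPolynomial (Fin c) K)} := by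
    rw [p.as_sum]
    refine Submodule.sum_mem _ fun d hd => ?_
    have hdeg : d.degree = n := hp.degree_eq_sum_deg_support hd |>.symm
    by_cases h : ∃ i ≠ last, d i ≠ 0
    · obtain ⟨i, hi, hdi⟩ := h
      have h1 : Finsupp.single i 1 + (d - Finsupp.single i 1) = d :=
        add_tsub_cancel_of_le (Finsupp.single_le_iff.2 (Nat.one_le_iff_ne_zero.2 hdi))
      -- Degree at least two leaves a second variable, so the monomial is divisible by a quadratic
      -- generator.
      have h2 : d - Finsupp.single i 1 ≠ 0 := fun h => by
        rw [h, add_zero] at h1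
        rw [← h1, Finsupp.degree_single] at hdeg
        omega
      obtain ⟨j, hj⟩ := Finsupp.ne_iff.1 h2
      have h3 : Finsupp.single j 1 + (d - Finsupp.single i 1 - Finsupp.single j 1) =
          d - Finsupp.single i 1 :=
        add_tsub_cancel_of_le (Finsupp.single_le_iff.2 (Nat.one_le_iff_ne_zero.2 hj))
      refine Submodule.mem_sup_left ?_
      rw [Submodule.restrictScalars_mem]
      have h4 : monomial d (coeff d p) =
          X i * X j * monomial (d - Finsupp.single i 1 - Finsupp.single j 1) (coeff d p) := by
        rw [X, X, monomial_mul, monomial_mul, add_assoc, h3, h1, one_mul, one_mul]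
      rw [h4]
      exact Ideal.mul_mem_right _ _ (X_mul_X_mem_normalFormIdeal hlast hi j)
    · push Not at h
      have h1 : d = Finsupp.single last n := by
        have h2 : d = Finsupp.single last (d last) := by
          ext i
          by_cases hi : i = last
          · simp [hi]
          · rw [h i hi, Finsupp.single_eq_of_ne hi]
        rw [h2, Finsupp.degree_single] at hdeg
        rw [h2, hdeg]
      refine Submodule.mem_sup_right (Submodule.mem_span_singleton.2 ⟨coeff d p, ?_⟩)
      rw [X_pow_eq_monomial, smul_monomial, h1, smul_eq_mul, mul_one]
  obtain ⟨q, hq, r, hr, h⟩ := Submodule.mem_sup.1 key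
  obtain ⟨a, rfl⟩ := Submodule.mem_span_singleton.1 hr
  refine ⟨a, ?_⟩
  rw [← h, smul_eq_C_mul, add_sub_cancel_right]
  exact hq

end NormalForm

/-! ### Ideals with `h`-vector `(1, c, 1, …, 1)` -/

section HVector

variable {K : Type*} [Field K] {c : ℕ} {I : Ideal (MvPolynomial (Fin c) K)}

theorem mk_mem_gradedPiece {n : ℤ} {p : MvPolynomial (Fin c) K} (hp : p ∈ piece K c n) :
    Ideal.Quotient.mk I p ∈ gradedPiece I n := by
  refine ⟨p, ?_, rfl⟩
  rwa [SetLike.mem_coe, twistPiece_eq_piece, sub_zero]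

theorem exists_mk_eq_of_mem_gradedPiece {n : ℤ} {x : MvPolynomial (Fin c) K ⧸ I}
    (hx : x ∈ gradedPiece I n) : ∃ p ∈ piece K c n, Ideal.Quotient.mk I p = x := by
  obtain ⟨p, hp, rfl⟩ := hx
  rw [SetLike.mem_coe, twistPiece_eq_piece, sub_zero] at hp
  exact ⟨p, hp, rfl⟩

instance finiteDimensional_gradedPiece (n : ℤ) : FiniteDimensional K (gradedPiece I n) := by
  rw [gradedPiece, twistPiece_eq_piece]
  infer_instance

theorem mem_of_hilbertFunction_eq_zero {n : ℤ} (h : hilbertFunction I n = 0)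
    {p : MvPolynomial (Fin c) K} (hp : p ∈ piece K c n) : p ∈ I := by
  have h1 := mk_mem_gradedPiece (I := I) hp
  rw [Submodule.finrank_eq_zero.1 h, Submodule.mem_bot] at h1
  exact Ideal.Quotient.eq_zero_iff_mem.1 h1

theorem hilbertFunction_of_neg {n : ℤ} (hn : n < 0) : hilbertFunction I n = 0 := by
  rw [hilbertFunction, gradedPiece, twistPiece_eq_piece, sub_zero, piece_of_neg hn,
    Submodule.map_bot, finrank_bot]

theorem hilbertFunction_eq_zero_of_le {n : ℤ} (h : ∀ p ∈ piece K c n, p ∈ I) :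
    hilbertFunction I n = 0 := by
  refine Submodule.finrank_eq_zero.2 ((Submodule.eq_bot_iff _).2 fun x hx => ?_)
  obtain ⟨p, hp, rfl⟩ := exists_mk_eq_of_mem_gradedPiece hx
  exact Ideal.Quotient.eq_zero_iff_mem.2 (h p hp)

theorem exists_generator_of_hilbertFunction_eq_one {n : ℤ} (h : hilbertFunction I n = 1) :
    ∃ w ∈ piece K c n, w ∉ I ∧ ∀ p ∈ piece K c n, ∃ a : K, p - C a * w ∈ I := by
  obtain ⟨⟨x, hx⟩, hx0, hgen⟩ := finrank_eq_one_iff'.1 h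
  obtain ⟨w, hw, rfl⟩ := exists_mk_eq_of_mem_gradedPiece hx
  refine ⟨w, hw, fun hwI => hx0 (Subtype.ext (Ideal.Quotient.eq_zero_iff_mem.2 hwI)),
    fun p hp => ?_⟩
  obtain ⟨a, ha⟩ := hgen ⟨_, mk_mem_gradedPiece hp⟩
  refine ⟨a, Ideal.Quotient.eq.1 ?_⟩
  rw [← smul_eq_C_mul]
  exact (congrArg Subtype.val ha).symm

/-- As $\dim R_1 \le c = \dim A_1$, the surjection $R_1 \to A_1$ is injective. -/
theorem eq_zero_of_hilbertFunction_one (h : hilbertFunction I 1 = c) {p : MvPolynomial (Fin c) K}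
    (hp : p ∈ piece K c 1) (hpI : p ∈ I) : p = 0 := by
  let f := (Ideal.Quotient.mkₐ K I).toLinearMap.domRestrict (piece K c 1)
  have h1 := LinearMap.finrank_range_add_finrank_ker f
  have h2 : Module.finrank K (LinearMap.range f) = c := by
    rw [LinearMap.range_domRestrict]
    exact h
  have h3 : Module.finrank K (piece K c 1) ≤ c := by
    have h := finrank_range_le_card (R := K) (X : Fin c → MvPolynomial (Fin c) K)
    rw [Set.finrank, ← homogeneousSubmodule_one_eq_span_X, Fintype.card_fin] at h
    exact h
  have h4 : LinearMap.ker f = ⊥ := Submodule.finrank_eq_zero.1 (by omega)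
  have h5 : (⟨p, hp⟩ : piece K c 1) ∈ LinearMap.ker f := Ideal.Quotient.eq_zero_iff_mem.2 hpI
  rw [h4, Submodule.mem_bot] at h5
  exact congrArg Subtype.val h5

theorem eq_zero_of_hilbertFunction_zero (h : hilbertFunction I 0 = 1) {p : MvPolynomial (Fin c) K}
    (hp : p.IsHomogeneous 0) (hpI : p ∈ I) : p = 0 := by
  obtain ⟨w, -, hw, -⟩ := exists_generator_of_hilbertFunction_eq_one h
  have hpC : p = C (coeff 0 p) := by
    rw [← homogeneousComponent_zero, homogeneousComponent_eq_self hp]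
  by_contra hp0
  have ha : coeff 0 p ≠ 0 := fun h => hp0 (by rw [hpC, h, C_0])
  have hunit : IsUnit p := by
    rw [hpC]
    exact (isUnit_iff_ne_zero.2 ha).map C
  exact hw (by rw [Ideal.eq_top_of_isUnit_mem I hpI hunit]; trivial)

/-- With no variables there is no nonzero form of degree 2. -/
theorem pos_of_hilbertFunction_two (h : hilbertFunction I 2 = 1) : 1 ≤ c := by
  by_contra! hc
  obtain rfl : c = 0 := by omega
  obtain ⟨w, hw, hwI, -⟩ := exists_generator_of_hilbertFunction_eq_one h
  refine absurd ((mem_piece_natCast (n := 2).1 hw).inj_right (isHomogeneous_of_isEmpty _ _ w)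
    fun h0 => hwI (h0 ▸ I.zero_mem)) two_ne_zero

theorem isHomogeneous_mem_of_X_mul {n : ℕ} (h : ∀ i, ∀ q : MvPolynomial (Fin c) K,
    q.IsHomogeneous n → X i * q ∈ I) {p : MvPolynomial (Fin c) K} (hp : p.IsHomogeneous (n + 1)) :
    p ∈ I := by
  rw [p.as_sum]
  refine Ideal.sum_mem _ fun d hd => ?_
  have hdeg : d.degree = n + 1 := hp.degree_eq_sum_deg_support hd |>.symm
  have hd0 : d ≠ 0 := fun h => by simp [h] at hdeg
  obtain ⟨i, hi⟩ := Finsupp.ne_iff.1 hd0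
  have h1 : Finsupp.single i 1 + (d - Finsupp.single i 1) = d :=
    add_tsub_cancel_of_le (Finsupp.single_le_iff.2 (Nat.one_le_iff_ne_zero.2 hi))
  have h2 : monomial d (coeff d p) = X i * monomial (d - Finsupp.single i 1) (coeff d p) := by
    rw [X, monomial_mul, h1, one_mul]
  rw [h2]
  refine h i _ (isHomogeneous_monomial _ ?_)
  rw [← h1, map_add, Finsupp.degree_single] at hdeg
  omega

/-- The products of linear forms modulo `I` are, up to scalars, products of the values of a
single functional. -/
theorem exists_functional (h2 : hilbertFunction I 2 = 1) (h3 : hilbertFunction I 3 = 1) :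
    ∃ lam : Fin c → K, lam ≠ 0 ∧ ∀ y : Fin c → K, y ⬝ᵥ lam = 0 →
      ∀ b, (∑ i, C (y i) * X i) * X b ∈ I := by
  obtain ⟨w, hw, hwI, hgen2⟩ := exists_generator_of_hilbertFunction_eq_one h2
  obtain ⟨τ, hτ, hτI, hgen3⟩ := exists_generator_of_hilbertFunction_eq_one h3
  have hX (i : Fin c) : X i ∈ piece K c 1 := mem_piece_natCast (n := 1).2 (isHomogeneous_X _ _)
  choose B hB using fun i j => hgen2 (X i * X j) (mul_mem_piece (hX i) (hX j))
  choose lam hlam using fun i => hgen3 (X i * w) (mul_mem_piece (hX i) hw)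
  have hprod (i j k) : X k * (X i * X j) - C (B i j * lam k) * τ ∈ I := by
    have : X k * (X i * X j) - C (B i j * lam k) * τ =
        X k * (X i * X j - C (B i j) * w) + C (B i j) * (X k * w - C (lam k) * τ) := by
      rw [C_mul]
      ring
    rw [this]
    exact I.add_mem (I.mul_mem_left _ (hB i j)) (I.mul_mem_left _ (hlam k))
  have hzero (a : K) (ha : C a * τ ∈ I) : a = 0 := by
    by_contra h
    refine hτI ?_
    have : τ = C a⁻¹ * (C a * τ) := by
      rw [← mul_assoc, ← C_mul, inv_mul_cancel₀ h, C_1, one_mul]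
    rw [this]
    exact I.mul_mem_left _ ha
  -- Both sides are the coefficient of `τ` in $x_ix_jx_k$.
  have hsymm (i j k) : B i j * lam k = B k j * lam i := by
    refine sub_eq_zero.1 (hzero _ ?_)
    have : C (B i j * lam k - B k j * lam i) * τ =
        (X i * (X k * X j) - C (B k j * lam i) * τ) -
          (X k * (X i * X j) - C (B i j * lam k) * τ) := by
      rw [C_sub]
      ring
    rw [this]
    exact I.sub_mem (hprod k j i) (hprod i j k)
  -- If $\lambda = 0$, then $R_1R_2 \subseteq I$, so $\tau \in I$.
  have hlam0 : lam ≠ 0 := by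
    rintro rfl
    refine hτI (isHomogeneous_mem_of_X_mul (n := 2) (fun i q hq => ?_)
      (mem_piece_natCast (n := 3).1 hτ))
    obtain ⟨a, ha⟩ := hgen2 q (mem_piece_natCast (n := 2).2 hq)
    have h := hlam i
    rw [Pi.zero_apply, C_0, zero_mul, sub_zero] at h
    have : X i * q = X i * (q - C a * w) + C a * (X i * w) := by ring
    rw [this]
    exact I.add_mem (I.mul_mem_left _ ha) (I.mul_mem_left _ h)
  refine ⟨lam, hlam0, fun y hy b => ?_⟩
  obtain ⟨p, hp⟩ := Function.ne_iff.1 hlam0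
  -- By symmetry $B_{ib}\lambda_p = B_{pb}\lambda_i$, so up to the nonzero factor $\lambda_p$ the
  -- sum is a multiple of $\sum y_i\lambda_i$.
  have hsum : ∑ i, y i * B i b = 0 := by
    refine (mul_eq_zero.1 ?_).resolve_right hp
    rw [Finset.sum_mul]
    calc ∑ i, y i * B i b * lam p = ∑ i, B p b * (y i * lam i) := by
          refine Finset.sum_congr rfl fun i _ => ?_
          rw [mul_assoc, hsymm]
          ring
      _ = B p b * (y ⬝ᵥ lam) := by rw [← Finset.mul_sum, dotProduct]
      _ = 0 := by rw [hy, mul_zero]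
  have : (∑ i, C (y i) * X i) * X b =
      ∑ i, C (y i) * (X i * X b - C (B i b) * w) + C (∑ i, y i * B i b) * w := by
    rw [map_sum, Finset.sum_mul, Finset.sum_mul, ← Finset.sum_add_distrib]
    refine Finset.sum_congr rfl fun i _ => ?_
    rw [C_mul]
    ring
  rw [this, hsum, C_0, zero_mul, add_zero]
  exact I.sum_mem fun i _ => I.mul_mem_left _ (hB i b)

variable {e : ℕ} {last : Fin c} {g h : Matrix (Fin c) (Fin c) K}

/-- One inclusion is `hle`. Conversely, $I$ has no nonzero elements in degrees 0 and 1; in degree $n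
\ge 2$ a form is a multiple of $x_{c-1}^n$ modulo the normal form ideal, and for $n \le e$ a nonzero
multiple would force $A_n = 0$. -/
theorem map_linearSubst_eq_normalFormIdeal (he : 1 ≤ e) (hI : IsHomogeneousIdeal I)
    (hvec : ∀ j : ℕ, j ≤ e → hilbertFunction I j = if j = 1 then c else 1)
    (hlast : (last : ℕ) + 1 = c) (hgh : g * h = 1) (hhg : h * g = 1)
    (hle : ∀ q ∈ normalFormIdeal K c e, linearSubst h q ∈ I) :
    I.map (linearSubst g) = normalFormIdeal K c e := by
  have hcancel (p : MvPolynomial (Fin c) K) : linearSubst h (linearSubst g p) = p :=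
    linearSubst_linearSubst_of_mul_eq_one hgh p
  apply le_antisymm
  · refine Ideal.map_le_iff_le_comap.2 fun p hp => ?_
    rw [Ideal.mem_comap, ← sum_homogeneousComponent p, map_sum]
    refine Ideal.sum_mem _ fun n _ => ?_
    have hpn := hI p hp n
    have hhom := homogeneousComponent_isHomogeneous n p
    generalize homogeneousComponent n p = q at hpn hhom
    rcases lt_or_ge n 2 with hn | hn
    · have hq : q = 0 := by
        have h0 := hvec n
        interval_cases n
        · exact eq_zero_of_hilbertFunction_zero (h0 (Nat.zero_le _)) hhom hpn
        · exact eq_zero_of_hilbertFunction_one (h0 he) (mem_piece_natCast (n := 1).2 hhom) hpn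
      rw [hq, map_zero]
      exact Ideal.zero_mem _
    · obtain ⟨a, ha⟩ := exists_sub_mem_normalFormIdeal (e := e) hlast hn
        (isHomogeneous_linearSubst g hhom)
      suffices C a * X last ^ n ∈ normalFormIdeal K c e by
        simpa using Ideal.add_mem _ ha this
      rcases lt_or_ge e n with hne | hne
      · exact Ideal.mul_mem_left _ _ (X_pow_mem_normalFormIdeal hlast hne)
      have h1 := hle _ ha
      rw [map_sub, map_mul, hcancel, algHom_C, algebraMap_eq] at h1
      have h2 : C a * linearSubst h (X last ^ n) ∈ I := by
        simpa using I.sub_mem hpn h1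
      have ha0 : a = 0 := by
        by_contra ha0
        have h3 : linearSubst h (X last ^ n) ∈ I := by
          have : linearSubst h (X last ^ n) = C a⁻¹ * (C a * linearSubst h (X last ^ n)) := by
            rw [← mul_assoc, ← C_mul, inv_mul_cancel₀ ha0, C_1, one_mul]
          rw [this]
          exact I.mul_mem_left _ h2
        have h4 : hilbertFunction I n = 0 := hilbertFunction_eq_zero_of_le fun r hr => by
          obtain ⟨b, hb⟩ := exists_sub_mem_normalFormIdeal (e := e) hlast hn
            (isHomogeneous_linearSubst g (mem_piece_natCast.1 hr))
          have h5 := hle _ hb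
          rw [map_sub, map_mul, hcancel, algHom_C, algebraMap_eq] at h5
          simpa using I.add_mem h5 (I.mul_mem_left (C b) h3)
        rw [hvec n hne, if_neg (by omega)] at h4
        exact one_ne_zero h4
      rw [ha0, C_0, zero_mul]
      exact Ideal.zero_mem _
  · intro q hq
    rw [← linearSubst_linearSubst_of_mul_eq_one hhg q]
    exact Ideal.mem_map_of_mem _ (hle q hq)

/-- All rows of `h` but the last are orthogonal to `lam`, so the forms they define annihilate $A_1$;
the remaining power has degree above the socle degree. -/
theorem linearSubst_mem_of_mem_normalFormIdeal (hsocle : IsSocleDegree I e)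
    (hlast : (last : ℕ) + 1 = c) {lam : Fin c → K}
    (hlam : ∀ y : Fin c → K, y ⬝ᵥ lam = 0 → ∀ b, (∑ i, C (y i) * X i) * X b ∈ I)
    (hh : h.mulVec lam = Pi.single last 1) {q : MvPolynomial (Fin c) K}
    (hq : q ∈ normalFormIdeal K c e) : linearSubst h q ∈ I := by
  refine normalFormIdeal_le (J := I.comap (linearSubst h)) hlast ?_ (fun i hi j => ?_) hq
  · refine mem_of_hilbertFunction_eq_zero (n := (e + 1 : ℕ)) (hsocle.2 _ (by omega)) ?_
    exact mem_piece_natCast.2 (isHomogeneous_linearSubst h (isHomogeneous_X_pow _ _))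
  · have hi0 : (h i) ⬝ᵥ lam = 0 := by
      have := congrFun hh i
      rwa [Pi.single_eq_of_ne hi] at this
    rw [Ideal.mem_comap, map_mul, linearSubst_X, linearSubst_X, Finset.mul_sum]
    refine I.sum_mem fun b _ => ?_
    rw [mul_left_comm]
    exact I.mul_mem_left _ (hlam _ hi0 b)

theorem exists_sub_mul_linearSubst_pow_mem (hlast : (last : ℕ) + 1 = c) (hgh : g * h = 1)
    (hle : ∀ q ∈ normalFormIdeal K c e, linearSubst h q ∈ I) {n : ℕ} (hn : 2 ≤ n)
    {p : MvPolynomial (Fin c) K} (hp : p.IsHomogeneous n) :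
    ∃ a : K, p - C a * linearSubst h (X last) ^ n ∈ I := by
  obtain ⟨a, ha⟩ := exists_sub_mem_normalFormIdeal (e := e) hlast hn
    (isHomogeneous_linearSubst g hp)
  refine ⟨a, ?_⟩
  have h1 := hle _ ha
  rwa [map_sub, map_mul, linearSubst_linearSubst_of_mul_eq_one hgh, algHom_C, algebraMap_eq,
    map_pow] at h1

end HVector

/-! ### The Betti table from the flag of linear forms. -/

section BettiTable

variable {K : Type*} [Field K] {c e : ℕ} {I : Ideal (MvPolynomial (Fin c) K)} {last : Fin c}
  {g h : Matrix (Fin c) (Fin c) K}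

theorem isHomogeneous_linearSubst_X (h : Matrix (Fin c) (Fin c) K) (i : Fin c) :
    linearSubst h (X i) ∈ piece K c 1 :=
  mem_piece_natCast (n := 1).2 (isHomogeneous_linearSubst h (isHomogeneous_X _ _))

/-- The kernel dimensions of multiplication by the successive forms of the flag. -/
def GradedFreeResolution.flagKer (F : GradedFreeResolution I) (g h : Matrix (Fin c) (Fin c) K)
    (k i : ℕ) (j : ℤ) : ℕ :=
  if hk : k < c then
    F.relKer (isHomogeneous_linearSubst_X h (flagIndex c k hk)) (flagIdeal g k) i j
  else 0

theorem GradedFreeResolution.flagKer_of_lt (F : GradedFreeResolution I)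
    (g h : Matrix (Fin c) (Fin c) K) {k : ℕ} (hk : k < c) (i : ℕ) (j : ℤ) :
    F.flagKer g h k i j =
      F.relKer (isHomogeneous_linearSubst_X h (flagIndex c k hk)) (flagIdeal g k) i j :=
  dif_pos hk

theorem bettiNumber_eq (he : 3 ≤ e) (hI : IsHomogeneousIdeal I) (hsocle : IsSocleDegree I e)
    (hvec : ∀ j : ℕ, j ≤ e → hilbertFunction I j = if j = 1 then c else 1)
    (hlast : (last : ℕ) + 1 = c) (hgh : g * h = 1) (hhg : h * g = 1)
    (hle : ∀ q ∈ normalFormIdeal K c e, linearSubst h q ∈ I) (F : GradedFreeResolution I) :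
    (∀ j : ℤ, F.bettiNumber 0 j = if j = 0 then 1 else 0) ∧
    ∀ (i : ℕ) (j : ℤ), (F.bettiNumber (i + 1) j : ℤ) =
      if j = e + i + 1 then ((c - 1).choose i : ℤ) else if j = i + 2 then
        (c : ℤ) * c.choose (i + 1) - c.choose (i + 2) - (c - 1).choose i else 0 := by
  have hc : 1 ≤ c := by omega
  let t (k i : ℕ) (j : ℤ) : ℕ := F.relBetti (flagIdeal g k) i j
  have hrow0 (j : ℤ) : t 0 0 j = hilbertFunction I j := by
    change F.relBetti (flagIdeal g 0) 0 j = _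
    rw [flagIdeal_zero hgh, F.relBetti_bot_zero hI]
  have hzero : ∀ k < c, ∀ j, t (k + 1) 0 (j + 1) + t k 0 j =
      t k 0 (j + 1) + F.flagKer g h k 0 j := fun k hk j => by
    rw [F.flagKer_of_lt g h hk]
    exact F.relBetti_zero _ (isHomogeneousIdeal_flagIdeal g k) (flagIdeal_succ hk hgh hhg) j
  have hsucc : ∀ k < c, ∀ i j, t (k + 1) (i + 1) (j + 1) + t k (i + 1) j =
      t k (i + 1) (j + 1) + F.flagKer g h k (i + 1) j + F.flagKer g h k i j :=
    fun k hk i j => by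
      rw [F.flagKer_of_lt g h hk, F.flagKer_of_lt g h hk]
      exact F.relBetti_succ _ (isHomogeneousIdeal_flagIdeal g k) (flagIdeal_succ hk hgh hhg)
        (fun p => mem_flagIdeal_of_mul_mem hk hhg) i j
  have hs : ∀ k < c, ∀ i j, F.flagKer g h k i j ≤ t k i j := fun k hk i j => by
    rw [F.flagKer_of_lt g h hk]
    exact F.relKer_le_relBetti _ (fun p => mem_flagIdeal_of_mul_mem hk hhg) i j
  have ht : ∀ k < c, ∀ i j, t k i j ≤ F.flagKer g h k i j + t k i (j + 1) := fun k hk i j => by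
    rw [F.flagKer_of_lt g h hk]
    exact F.relBetti_le_relKer_add _ i j
  have h0 : t 0 0 0 = 1 := (hrow0 0).trans (hvec 0 (Nat.zero_le e))
  have h1 : t 0 0 1 = c := (hrow0 1).trans (hvec 1 (by omega))
  have h2 : ∀ j : ℤ, 2 ≤ j → j ≤ e → t 0 0 j = 1 := fun j hj hje => by
    lift j to ℕ using by omega
    rw [hrow0, hvec j (by omega), if_neg (by omega)]
  have hneg : ∀ j < 0, t 0 0 j = 0 := fun j hj => (hrow0 j).trans (hilbertFunction_of_neg hj)
  have hgt : ∀ j > (e : ℤ), t 0 0 j = 0 := fun j hj => (hrow0 j).trans (hsocle.2 j hj)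
  have hacyclic : ∀ i j, t 0 (i + 1) j = 0 := fun i j => by
    change F.relBetti (flagIdeal g 0) (i + 1) j = 0
    rw [flagIdeal_zero hgh, F.relBetti_bot_succ]
  -- The first form of the flag corresponds to $x_{c-1}$, and its powers span $A$ in degrees at
  -- least 2.
  have hone : ∀ j, 2 ≤ j → t 1 0 j = 0 := fun j hj => by
    refine F.relBetti_zero_eq_zero hI fun p hp => ?_
    lift j to ℕ using by omega
    obtain ⟨a, ha⟩ := exists_sub_mul_linearSubst_pow_mem (e := e) hlast hgh hle
      (show 2 ≤ j by omega) (mem_piece_natCast.1 hp)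
    refine ⟨_, ?_, ?_, ha⟩
    · refine Ideal.mul_mem_left _ _ (Ideal.pow_mem_of_mem _ ?_ j (by omega))
      rw [mem_flagIdeal, linearSubst_linearSubst_of_mul_eq_one hhg]
      refine Ideal.subset_span (Set.mem_image_of_mem _ ?_)
      simp only [lastIndices, Set.mem_ofPred_eq]
      omega
    · have h := (isHomogeneous_linearSubst h (isHomogeneous_X K last)).pow j
      rw [one_mul] at h
      exact mem_piece_natCast.2 (h.C_mul a)
  have hlast' : t c 0 1 = 0 := by
    refine F.relBetti_zero_eq_zero hI fun p hp => ⟨p, ?_, hp, by simp⟩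
    rw [flagIdeal_card, RingHom.mem_ker, constantCoeff_eq]
    exact (mem_piece_natCast (n := 1).1 hp).coeff_eq_zero (by simp)
  have hbetti (i : ℕ) (j : ℤ) : F.bettiNumber i j = t c i j := by
    rw [F.bettiNumber_eq_relBetti, ← flagIdeal_card g]
  constructor
  · intro j
    have := recurrence_row_zero hzero hs h0 h1 hneg hone hlast' hc le_rfl j
    rw [hbetti]
    split_ifs at this ⊢ <;> omega
  · intro i j
    have := recurrence_row_succ (k := c - 1) hc he hsucc hzero hs ht h0 h1 h2 hneg hgt hacyclic
      hone hlast' (by omega) i j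
    rwa [Nat.sub_add_cancel hc, ← hbetti] at this

end BettiTable

/-- Absorption combined with Pascal's rule; it turns the closed form of the recurrence into the
stated one. -/
theorem mul_choose_succ_eq (c i : ℕ) :
    (i : ℤ) * (c + 1).choose (i + 1) = c * c.choose i - c.choose (i + 1) := by
  have h1 : ((c : ℤ) + 1) * c.choose i = (c + 1).choose (i + 1) * (i + 1) := by
    exact_mod_cast Nat.add_one_mul_choose_eq c i
  have h2 : ((c + 1).choose (i + 1) : ℤ) = c.choose i + c.choose (i + 1) := by
    exact_mod_cast Nat.choose_succ_succ' c i
  linear_combination -h1 - h2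

end BettiOfHVector
end

theorem mainTheorem7 {K : Type*} [Field K] [IsAlgClosed K] [CharZero K] (c e : ℕ) (he : 3 ≤ e)
    (I : Ideal (MvPolynomial (Fin c) K))
    (hI : BettiOfHVector.IsHomogeneousIdeal I)
    (hA : IsArtinianRing (MvPolynomial (Fin c) K ⧸ I))
    (hsocle : BettiOfHVector.IsSocleDegree I e)
    (hvec : ∀ j : ℕ, j ≤ e → BettiOfHVector.hilbertFunction I j = if j = 1 then c else 1) :
    (∃ g : GL (Fin c) K,
      I.map (BettiOfHVector.linearSubst (g : Matrix (Fin c) (Fin c) K)) =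
        BettiOfHVector.normalFormIdeal K c e) ∧
    Nonempty (BettiOfHVector.GradedFreeResolution I) ∧
    ∀ F : BettiOfHVector.GradedFreeResolution I,
      (∀ j : ℤ, F.bettiNumber 0 j = if j = 0 then 1 else 0) ∧
      (∀ i : ℕ, 1 ≤ i → i ≤ c →
        F.bettiNumber i ((e : ℤ) + i) = (c - 1).choose (i - 1) ∧
        (F.bettiNumber i ((i : ℤ) + 1) : ℤ) =
          (i : ℤ) * (c + 1).choose (i + 1) - (c - 1).choose (i - 1) ∧
        ∀ j : ℤ, j ≠ (e : ℤ) + i → j ≠ (i : ℤ) + 1 → F.bettiNumber i j = 0) ∧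
      (∀ i : ℕ, c < i → ∀ j : ℤ, F.bettiNumber i j = 0) := by
  have hc : 1 ≤ c := BettiOfHVector.pos_of_hilbertFunction_two (hvec 2 (by omega))
  have hlast : ((⟨c - 1, by omega⟩ : Fin c) : ℕ) + 1 = c := Nat.sub_add_cancel hc
  obtain ⟨lam, hlam0, hlam⟩ := BettiOfHVector.exists_functional (hvec 2 (by omega)) (hvec 3 he)
  obtain ⟨g, h, hgh, hhg, hh⟩ := BettiOfHVector.exists_matrix_mulVec_eq hlam0 ⟨c - 1, by omega⟩
  have hle : ∀ q ∈ BettiOfHVector.normalFormIdeal K c e, BettiOfHVector.linearSubst h q ∈ I :=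
    fun q => BettiOfHVector.linearSubst_mem_of_mem_normalFormIdeal hsocle hlast hlam hh
  refine ⟨⟨⟨g, h, hgh, hhg⟩, BettiOfHVector.map_linearSubst_eq_normalFormIdeal (by omega) hI hvec
    hlast hgh hhg hle⟩, BettiOfHVector.nonempty_gradedFreeResolution hI, fun F => ?_⟩
  obtain ⟨h0, hsucc⟩ := BettiOfHVector.bettiNumber_eq he hI hsocle hvec hlast hgh hhg hle F
  refine ⟨h0, fun i hi hic => ?_, fun i hi j => ?_⟩
  · obtain ⟨i, rfl⟩ := Nat.exists_eq_add_of_le' hi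
    refine ⟨?_, ?_, fun j hj1 hj2 => ?_⟩
    · have := hsucc i (e + (i + 1 : ℕ))
      rw [if_pos (by push_cast; ring)] at this
      exact_mod_cast this
    -- The degrees $i+1$ and $e+i$ are distinct because $e \ge 3$.
    · rw [hsucc, if_neg (by push_cast; omega), if_pos (by push_cast; ring),
        BettiOfHVector.mul_choose_succ_eq, Nat.add_sub_cancel]
    · have := hsucc i j
      rw [if_neg (by push_cast at hj1; omega), if_neg (by push_cast at hj2; omega)] at this
      exact_mod_cast this
  · obtain ⟨i, rfl⟩ := Nat.exists_eq_add_of_le' (show 1 ≤ i by omega)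
    have := hsucc i j
    -- The closed form holds for every positive homological degree; beyond $c$ all its binomials
    -- vanish.
    rw [Nat.choose_eq_zero_of_lt (show c - 1 < i by omega), Nat.choose_eq_zero_of_lt hi,
      Nat.choose_eq_zero_of_lt (show c < i + 2 by omega)] at this
    simpa using this
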